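/- Let $D=\{x\in\mathbb R^3: x_1^2+x_2^2\le 1,\ 0\le x_3\le 1\}$, let $r=\sqrt{x_1^2+x_2^2}$ and $e_\theta=(-x_2/r,x_1/r,0)$, and let $0<T<\infty$. Write $L^q_tL^p_x=L^q(0,T;L^p(D))$, and similarly $L^2_tH^1_x=L^2(0,T;H^1(D))$. Let $k$ be an integer with $1\le k\le 3$, let $k-1\le\alpha<k$, and let $1\le q\le\infty$, $1\le p<\infty$ satisfy $$[(3-\alpha)p-2]\,q<2$$ (for $q=\infty$ this means $(3-\alpha)p\le 2$). Then there are a force $f\in L^q_tL^p_x$ and a velocity field $v\in L^\infty_tL^2_x\cap L^2_tH^1_x$ with the following properties. 1. $f$ and $v$ are smooth in $D\times[0,T)$, and for some pressure $P$, also smooth in $D\times[0,T)$, $$\Delta v-v\cdot\nabla v-\nabla P-\partial_tv=f,\qquad \nabla\cdot v=0\qquad\text{in }D\times[0,T),$$ with the no-slip condition $v=0$ on the vertical boundary $\{x_1^2+x_2^2=1\}$ of $D$ and the Navier total slip condition $v_3=0$, $\partial_{x_3}v_1=\partial_{x_3}v_2=0$ on the horizontal boundary $\{x_3=0\}\cup\{x_3=1\}$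 of $D$. 2. $v$ is unique: every smooth solution $w$ in $D\times[0,T)$ (with some smooth pressure) of the same equations with the same $f$, the same boundary conditions and $w(\cdot,0)=v(\cdot,0)$ equals $v$. Moreover $v$ is a Leray–Hopf weak solution (a weak solution in $L^\infty_tL^2_x\cap L^2_tH^1_x$ satisfying the energy inequality) for the force $f$, the initial velocity $v(\cdot,0)$ and these boundary conditions, and every Leray–Hopf weak solution for these data equals $v$ almost everywhere in $D\times(0,T)$. 3. $v$ is purely swirling: $v=[\,r^\alpha\phi(r,t)-\phi(1,t)\,r\,]\,e_\theta$ for some function $\phi$, smooth in $[0,1]\times[0,T)$, with $\phi(0,t)=0$. 4. $\|\nabla^{k-1}v(\cdot,t)\|_{L^\infty(D)}\to\infty$ as $t\to T^-$. 5. $v\in L^{\tilde q}_tL^{\tilde p}_x$ for all $1\le\tilde q\le\infty$, $1\le\tilde p<\infty$ with $[(1-\alpha)\tilde p-2]\,\tilde q<2$ (for $\tilde q=\infty$: $(1-\alpha)\tilde p\le 2$). 6. If $k\ge2$, then $v$ extends to a function of class $C^{k-2}$ on $D\times[0,T]$. -/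

import Mathlib

open MeasureTheory Set Filter Topology
open scoped ENNReal ContDiff

noncomputable section

namespace SwirlNS

/-- Euclidean three-space; the coordinates `x 0`, `x 1`, `x 2` are `x₁`, `x₂`, `x₃`. -/
abbrev E3 : Type := EuclideanSpace ℝ (Fin 3)

/-- The (closed) cylinder `D = B₂(0,1) × [0,1]`. -/
def cyl : Set E3 := {x | x 0 ^ 2 + x 1 ^ 2 ≤ 1 ∧ 0 ≤ x 2 ∧ x 2 ≤ 1}

/-- The vertical (lateral) part of the boundary of `D`. -/
def vertBdry : Set E3 := {x | x 0 ^ 2 + x 1 ^ 2 = 1 ∧ 0 ≤ x 2 ∧ x 2 ≤ 1}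

/-- The horizontal part of the boundary of `D`. -/
def horBdry : Set E3 := {x | x 0 ^ 2 + x 1 ^ 2 ≤ 1 ∧ (x 2 = 0 ∨ x 2 = 1)}

/-- Distance to the axis. -/
def rad (x : E3) : ℝ := Real.sqrt (x 0 ^ 2 + x 1 ^ 2)

/-- The angular unit vector `e_θ = (-x₂/r, x₁/r, 0)` (zero on the axis). -/
def eTheta (x : E3) : E3 := !₂[-(x 1) / rad x, x 0 / rad x, 0]

/-- The partial derivative `∂_j u` of a function on `D` (one-sided on the boundary). -/
def pd {F : Type*} [NormedAddCommGroup F] [NormedSpace ℝ F] (j : Fin 3) (u : E3 → F) (x : E3) : F :=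
  fderivWithin ℝ u cyl x (EuclideanSpace.single j 1)

/-- The componentwise Laplacian on `D`. -/
def lap (u : E3 → E3) (x : E3) : E3 := ∑ j, pd j (pd j u) x

/-- The divergence on `D`. -/
def dvg (u : E3 → E3) (x : E3) : ℝ := ∑ j, pd j u x j

/-- `(a · ∇) u` on `D`. -/
def convect (a : E3 → E3) (u : E3 → E3) (x : E3) : E3 := fderivWithin ℝ u cyl x (a x)

/-- The time derivative of `u` on `[0,T)` (one-sided at `t = 0`). -/
def dt (T : ℝ) (u : ℝ → E3 → E3) (t : ℝ) (x : E3) : E3 :=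
  derivWithin (fun s => u s x) (Ico 0 T) t

/-- `g` is smooth in `D × [0,T)`, up to the boundary of `D` and the initial time. -/
def SmoothST {F : Type*} [NormedAddCommGroup F] [NormedSpace ℝ F] (T : ℝ) (g : ℝ → E3 → F) : Prop :=
  ContDiffOn ℝ ∞ (fun z : ℝ × E3 => g z.1 z.2) (Ico 0 T ×ˢ cyl)

/-- `g ∈ L^q(0,T; L^p(D))`. -/
def MemLtLx {F : Type*} [NormedAddCommGroup F] (T : ℝ) (q p : ℝ≥0∞) (g : ℝ → E3 → F) : Prop :=
  AEStronglyMeasurable (fun z : ℝ × E3 => g z.1 z.2)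
    ((volume.restrict (Ioo 0 T)).prod (volume.restrict cyl)) ∧
  eLpNorm (fun t => eLpNorm (g t) p (volume.restrict cyl)) q (volume.restrict (Ioo 0 T)) < ⊤

/-- `G j` (`j = 0, 1, 2`) is the weak partial derivative `∂_j u` in the interior of `D`. -/
def IsWeakGrad (u : E3 → E3) (G : Fin 3 → E3 → E3) : Prop :=
  ∀ i j, ∀ ψ : E3 → ℝ, ContDiff ℝ ∞ ψ → HasCompactSupport ψ → tsupport ψ ⊆ interior cyl →
    ∫ x in cyl, u x i * fderiv ℝ ψ x (EuclideanSpace.single j 1) = - ∫ x in cyl, G j x i * ψ x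

/-- `g ∈ L²(0,T; H¹(D))`. -/
def MemLtwoHone (T : ℝ) (g : ℝ → E3 → E3) : Prop :=
  MemLtLx T 2 2 g ∧ ∃ G : Fin 3 → ℝ → E3 → E3,
    (∀ j, MemLtLx T 2 2 (G j)) ∧
    ∀ᵐ t ∂(volume.restrict (Ioo 0 T)), IsWeakGrad (g t) (fun j => G j t)

/-- No slip on the vertical boundary: `u = 0` there. -/
def NoSlipVert (u : E3 → E3) : Prop := ∀ x ∈ vertBdry, u x = 0

/-- Navier total slip on the horizontal boundary: `u₃ = 0` and `∂₃u₁ = ∂₃u₂ = 0` there. -/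
def TotalSlipHor (u : E3 → E3) : Prop :=
  ∀ x ∈ horBdry, u x 2 = 0 ∧ pd 2 u x 0 = 0 ∧ pd 2 u x 1 = 0

/-- `v` is a classical (smooth) solution in `D × [0,T)` of the Navier–Stokes equations
`Δv - v·∇v - ∇P - ∂ₜv = f`, `div v = 0`, for some smooth pressure `P`, under the no slip condition
on the vertical and the total slip condition on the horizontal boundary. -/
def IsClassicalSolution (T : ℝ) (f v : ℝ → E3 → E3) : Prop :=
  SmoothST T v ∧
  (∃ P : ℝ → E3 → ℝ, SmoothST T P ∧ ∀ t ∈ Ico 0 T, ∀ x ∈ cyl,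
    lap (v t) x - convect (v t) (v t) x - gradientWithin (P t) cyl x - dt T v t x = f t x) ∧
  (∀ t ∈ Ico 0 T, ∀ x ∈ cyl, dvg (v t) x = 0) ∧
  (∀ t ∈ Ico 0 T, NoSlipVert (v t)) ∧
  (∀ t ∈ Ico 0 T, TotalSlipHor (v t))

/-- `G` is the weak gradient of `u` in `D`, and `u = 0` on the vertical boundary, `u₃ = 0` on the
horizontal boundary, in the sense of traces: integration by parts holds without boundary term
against every `ψ` smooth on the closed cylinder; only for the pairs `(u₁, ∂₃)`, `(u₂, ∂₃)`, for
which no condition is imposed on the horizontal boundary, `ψ` has to vanish there. -/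
def IsWeakGradBC (u : E3 → E3) (G : Fin 3 → E3 → E3) : Prop :=
  ∀ i j, ∀ ψ : E3 → ℝ, ContDiffOn ℝ ∞ ψ cyl →
    (i ≠ 2 → j = 2 → ∀ x ∈ horBdry, ψ x = 0) →
    ∫ x in cyl, u x i * pd j ψ x = - ∫ x in cyl, G j x i * ψ x

/-- Test fields of the weak formulation: smooth in `D × [0,T)`, vanishing near `t = T`, divergence
free, zero on the vertical boundary and tangential on the horizontal boundary. -/
def IsTestField (T : ℝ) (ψ : ℝ → E3 → E3) : Prop :=
  SmoothST T ψ ∧ (∃ S < T, ∀ t ∈ Ico S T, ∀ x ∈ cyl, ψ t x = 0) ∧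
  (∀ t ∈ Ico 0 T, ∀ x ∈ cyl, dvg (ψ t) x = 0) ∧
  (∀ t ∈ Ico 0 T, NoSlipVert (ψ t)) ∧
  (∀ t ∈ Ico 0 T, ∀ x ∈ horBdry, ψ t x 2 = 0)

/-- `w ∈ L^∞(0,T; L²) ∩ L²(0,T; H¹)` is a Leray–Hopf weak solution in `D × [0,T)` with force `f`
and initial velocity `v₀`: weak formulation and energy inequality. The condition
`∂₃w₁ = ∂₃w₂ = 0` on the horizontal boundary is the natural one of the weak formulation. -/
def IsLerayHopf (T : ℝ) (f : ℝ → E3 → E3) (v₀ : E3 → E3) (w : ℝ → E3 → E3) : Prop :=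
  MemLtLx T ⊤ 2 w ∧
  ∃ G : Fin 3 → ℝ → E3 → E3,
    (∀ j, MemLtLx T 2 2 (G j)) ∧
    (∀ᵐ t ∂(volume.restrict (Ioo 0 T)), IsWeakGradBC (w t) (fun j => G j t)) ∧
    (∀ᵐ t ∂(volume.restrict (Ioo 0 T)), ∀ᵐ x ∂(volume.restrict cyl), ∑ j, G j t x j = 0) ∧
    (∀ ψ : ℝ → E3 → E3, IsTestField T ψ →
      (∫ t in Ioo 0 T, ∫ x in cyl,
        (inner ℝ (w t x) (dt T ψ t x) + inner ℝ (w t x) (convect (w t) (ψ t) x)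
          - ∑ j, inner ℝ (G j t x) (pd j (ψ t) x) - inner ℝ (f t x) (ψ t x)))
        + ∫ x in cyl, inner ℝ (v₀ x) (ψ 0 x) = 0) ∧
    (∀ᵐ t ∂(volume.restrict (Ioo 0 T)),
      (1 / 2) * (∫ x in cyl, ‖w t x‖ ^ 2) + ∫ s in Ioo 0 t, ∫ x in cyl, ∑ j, ‖G j s x‖ ^ 2
        ≤ (1 / 2) * (∫ x in cyl, ‖v₀ x‖ ^ 2) - ∫ s in Ioo 0 t, ∫ x in cyl, inner ℝ (f s x) (w s x))

/-- `v = [r^α φ(r,t) - φ(1,t) r] e_θ` in `D × [0,T)`, with `φ` smooth and `φ(0,t) = 0`. -/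
def IsSwirl (T α : ℝ) (v : ℝ → E3 → E3) : Prop :=
  ∃ φ : ℝ → ℝ → ℝ,
    ContDiffOn ℝ ∞ (fun z : ℝ × ℝ => φ z.1 z.2) (Icc 0 1 ×ˢ Ico 0 T) ∧
    (∀ t ∈ Ico 0 T, φ 0 t = 0) ∧
    ∀ t ∈ Ico 0 T, ∀ x ∈ cyl, v t x = (rad x ^ α * φ (rad x) t - φ 1 t * rad x) • eTheta x

end SwirlNS

end

open SwirlNS

noncomputable section

/-! The solution is explicit. Put ρ = (1 - t/T)^γ and v(x,t) = ρ^(β-1) Φ(x/ρ), where Φ(y) = η(y₁² +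
y₂²)(-y₂, y₁, 0) and the bump η of the squared radius is supported in [1/4, 3/4]. This is a swirl in
an annulus of radius about ρ that shrinks to the axis. It vanishes near the axis and near the
vertical boundary and does not depend on x₃, so both boundary conditions hold. The centrifugal term
v·∇v is radial and is cancelled by a pressure (`fderiv_profile_self_add_pressure`). Hence v solves
the equations with the force f = Δv - ∂ₜv (`isClassicalSolution_velocity`).

The rest is counting of powers. A field of size ρ^b on the tube r ≤ ρ, of volume about ρ², has L^p
norm of order at most ρ^(b+2/p) (`memLtLx_of_concentrating`). Here b = β-1 for v, b = β-2 for ∇v and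
b = β-3 for Δv; the condition γ ≥ 1/2 keeps ∂ₜv within the bound for Δv. The choices β = max(α, k -
1/2) and γ = max(1/2, 1/(3-β)) serve all integrability claims. The derivatives of order k-1 grow at
least like ρ^(β-k) with β < k: v vanishes near the origin but has size ρ^(β-1) at a distance of
order ρ from it, so a Taylor estimate bounds these derivatives from below
(`le_eLpNorm_iteratedFDerivWithin_velocity`). For k ≥ 2 the field tends to 0 uniformly as t → T, and
for k = 3 so do its first derivatives in space and time, so extension by zero has the claimed
regularity.

Uniqueness does not use the special form of v: it is weak-strong uniqueness for any classical
solution. On (0,S) with S < T the gradient of v is bounded. The energy inequality for w, the energy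
identity for v and the weak formulation for w tested with θ(t)v combine to ½‖w-v‖²(t) ≤ K∫₀ᵗ‖w-v‖²
(`IsClassicalSolution.relative_energy`), and Gronwall concludes. A smooth competitor is a Leray–Hopf
solution on every such (0,S), so it is covered as well. -/

namespace SwirlNS

/-! ### Geometry of the cylinder -/

theorem convex_cyl : Convex ℝ cyl := by
  intro x hx y hy a b ha hb hab
  obtain ⟨hx1, hx2, hx3⟩ := hx
  obtain ⟨hy1, hy2, hy3⟩ := hy
  have hb' : b = 1 - a := by linarith
  subst hb'
  refine ⟨?_, ?_, ?_⟩ <;> simp only [PiLp.add_apply, PiLp.smul_apply, smul_eq_mul]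
  · nlinarith [mul_nonneg ha hb, sq_nonneg (x 0 - y 0), sq_nonneg (x 1 - y 1),
      mul_nonneg (mul_nonneg ha hb) (sq_nonneg (x 0 - y 0)),
      mul_nonneg (mul_nonneg ha hb) (sq_nonneg (x 1 - y 1)),
      mul_nonneg ha (sub_nonneg.2 hx1), mul_nonneg hb (sub_nonneg.2 hy1)]
  · positivity
  · nlinarith [mul_nonneg ha (sub_nonneg.2 hx3), mul_nonneg hb (sub_nonneg.2 hy3)]

theorem isClosed_cyl : IsClosed cyl := by
  have h0 : Continuous fun x : E3 => x 0 ^ 2 + x 1 ^ 2 := by fun_prop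
  have h2 : Continuous fun x : E3 => x 2 := by fun_prop
  exact (isClosed_le h0 continuous_const).inter
    ((isClosed_le continuous_const h2).inter (isClosed_le h2 continuous_const))

theorem norm_sq_E3 (x : E3) : ‖x‖ ^ 2 = x 0 ^ 2 + x 1 ^ 2 + x 2 ^ 2 := by
  rw [EuclideanSpace.norm_sq_eq, Fin.sum_univ_three]
  simp only [Real.norm_eq_abs, sq_abs]

theorem isCompact_cyl : IsCompact cyl := by
  refine Metric.isCompact_of_isClosed_isBounded isClosed_cyl ?_
  refine (Metric.isBounded_closedBall (x := (0 : E3)) (r := 2)).subset fun x hx => ?_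
  rw [mem_closedBall_zero_iff]
  obtain ⟨hx1, hx2, hx3⟩ := hx
  have := norm_sq_E3 x
  nlinarith [norm_nonneg x]

theorem measurableSet_cyl : MeasurableSet cyl := isClosed_cyl.measurableSet

theorem mem_interior_cyl {x : E3} (h : x 0 ^ 2 + x 1 ^ 2 < 1) (h0 : 0 < x 2) (h1 : x 2 < 1) :
    x ∈ interior cyl := by
  have c0 : Continuous fun x : E3 => x 0 ^ 2 + x 1 ^ 2 := by fun_prop
  have c2 : Continuous fun x : E3 => x 2 := by fun_prop
  have ho : IsOpen {x : E3 | x 0 ^ 2 + x 1 ^ 2 < 1 ∧ 0 < x 2 ∧ x 2 < 1} :=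
    (isOpen_lt c0 continuous_const).inter
      ((isOpen_lt continuous_const c2).inter (isOpen_lt c2 continuous_const))
  have hs : {x : E3 | x 0 ^ 2 + x 1 ^ 2 < 1 ∧ 0 < x 2 ∧ x 2 < 1} ⊆ cyl :=
    fun y hy => ⟨hy.1.le, hy.2.1.le, hy.2.2.le⟩
  exact interior_maximal hs ho ⟨h, h0, h1⟩

theorem interior_cyl_nonempty : (interior cyl).Nonempty :=
  ⟨!₂[0, 0, 1 / 2], mem_interior_cyl (by norm_num) (by simp) (by simp; norm_num)⟩

theorem uniqueDiffOn_cyl : UniqueDiffOn ℝ cyl :=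
  uniqueDiffOn_convex convex_cyl interior_cyl_nonempty

theorem cyl_subset_closure_interior : cyl ⊆ closure (interior cyl) := by
  rw [convex_cyl.closure_interior_eq_closure_of_nonempty_interior interior_cyl_nonempty]
  exact subset_closure

/-- An interior point can be moved both ways along the axis without leaving the cylinder. Test
functions supported in the interior therefore meet the boundary requirement in `IsWeakGradBC`. -/
theorem not_mem_horBdry_of_interior {x : E3} (hx : x ∈ interior cyl) : x ∉ horBdry := by
  intro hb
  have hc : ContinuousAt (fun s : ℝ => x + s • EuclideanSpace.single (2 : Fin 3) (1 : ℝ)) 0 := by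
    fun_prop
  have hm : ∀ᶠ s : ℝ in 𝓝 0, x + s • EuclideanSpace.single (2 : Fin 3) (1 : ℝ) ∈ cyl := by
    apply hc.eventually_mem
    simpa using mem_interior_iff_mem_nhds.1 hx
  obtain ⟨ε, hε, h⟩ := Metric.eventually_nhds_iff.1 hm
  have h1 := h (y := ε / 2) (by rw [dist_zero_right, Real.norm_eq_abs, abs_of_pos] <;> linarith)
  have h2 := h (y := -(ε / 2)) (by
    rw [dist_zero_right, norm_neg, Real.norm_eq_abs, abs_of_pos] <;> linarith)
  have e1 := h1.2.2
  have e2 := h2.2.1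
  simp at e1 e2
  rcases hb.2 with h | h <;> linarith

instance instFiniteCyl : IsFiniteMeasure ((volume : Measure E3).restrict cyl) :=
  ⟨by rw [Measure.restrict_apply_univ]; exact isCompact_cyl.measure_lt_top⟩

theorem horBdry_subset_cyl : horBdry ⊆ cyl := fun x hx => ⟨hx.1, by
  rcases hx.2 with h | h <;> rw [h] <;> norm_num⟩

/-! ### Derivatives of space-time smooth functions -/

section smooth
variable {F : Type*} [NormedAddCommGroup F] [NormedSpace ℝ F]

theorem uniqueDiffOn_Ico_zero (T : ℝ) : UniqueDiffOn ℝ (Ico 0 T) := uniqueDiffOn_Ico 0 T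

theorem SmoothST.slice {T : ℝ} {g : ℝ → E3 → F} (hg : SmoothST T g) {t : ℝ} (ht : t ∈ Ico 0 T) :
    ContDiffOn ℝ ∞ (g t) cyl :=
  ContDiffOn.comp (s := cyl) (f := fun x : E3 => (t, x)) hg (by fun_prop) fun _ hx => ⟨ht, hx⟩

theorem SmoothST.timeSlice {T : ℝ} {g : ℝ → E3 → F} (hg : SmoothST T g) {x : E3} (hx : x ∈ cyl) :
    ContDiffOn ℝ ∞ (fun t => g t x) (Ico 0 T) :=
  ContDiffOn.comp (s := Ico 0 T) (f := fun t : ℝ => (t, x)) hg (by fun_prop) fun _ ht => ⟨ht, hx⟩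

/-- Time is a parameter here: the family is differentiated in a second copy of the space variable,
which is then set equal to the first. -/
theorem SmoothST.fderivWithin {T : ℝ} {g : ℝ → E3 → F} (hg : SmoothST T g) :
    SmoothST T (fun t x => _root_.fderivWithin ℝ (g t) cyl x) := by
  intro z hz
  have hg' : ContDiffOn ℝ ∞ (Function.uncurry fun z : ℝ × E3 => g z.1)
      ((Ico 0 T ×ˢ cyl) ×ˢ cyl) :=
    ContDiffOn.comp (f := fun z : (ℝ × E3) × E3 => (z.1.1, z.2)) hg
      (by fun_prop) fun z hz => ⟨hz.1.1, hz.2⟩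
  exact ContDiffWithinAt.fderivWithin (f := fun z : ℝ × E3 => g z.1) (g := Prod.snd) (n := ∞)
    (hg' (z, z.2) ⟨hz, hz.2⟩) contDiffWithinAt_snd uniqueDiffOn_cyl (by simp) hz
    (fun y hy => hy.2)

theorem SmoothST.pd {T : ℝ} {g : ℝ → E3 → F} (hg : SmoothST T g) (j : Fin 3) :
    SmoothST T (fun t => pd j (g t)) :=
  ContDiffOn.clm_apply hg.fderivWithin contDiffOn_const

theorem SmoothST.derivTime {T : ℝ} {g : ℝ → E3 → F} (hg : SmoothST T g) :
    SmoothST T (fun t x => derivWithin (fun s => g s x) (Ico 0 T) t) := by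
  intro z hz
  have hg' : ContDiffOn ℝ ∞ (Function.uncurry fun (z : ℝ × E3) s => g s z.2)
      ((Ico 0 T ×ˢ cyl) ×ˢ Ico 0 T) :=
    ContDiffOn.comp (f := fun z : (ℝ × E3) × ℝ => (z.2, z.1.2)) hg
      (by fun_prop) fun z hz => ⟨hz.2, hz.1.2⟩
  have := ContDiffWithinAt.fderivWithin (f := fun (z : ℝ × E3) s => g s z.2) (g := Prod.fst)
    (n := ∞) (m := ∞)
    (hg' (z, z.1) ⟨hz, hz.1⟩) contDiffWithinAt_fst (uniqueDiffOn_Ico_zero T) (by simp) hz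
    (fun y hy => hy.1)
  exact this.clm_apply (contDiffWithinAt_const (c := (1 : ℝ)))

theorem SmoothST.dt {T : ℝ} {v : ℝ → E3 → E3} (hv : SmoothST T v) : SmoothST T (dt T v) :=
  hv.derivTime

theorem SmoothST.lap {T : ℝ} {v : ℝ → E3 → E3} (hv : SmoothST T v) :
    SmoothST T (fun t => lap (v t)) :=
  ContDiffOn.sum fun j _ => (hv.pd j).pd j

theorem SmoothST.convect {T : ℝ} {a u : ℝ → E3 → E3} (ha : SmoothST T a) (hu : SmoothST T u) :
    SmoothST T (fun t => convect (a t) (u t)) :=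
  ContDiffOn.clm_apply hu.fderivWithin ha

theorem SmoothST.gradient {T : ℝ} {P : ℝ → E3 → ℝ} (hP : SmoothST T P) :
    SmoothST T (fun t => gradientWithin (P t) cyl) :=
  ((InnerProductSpace.toDual ℝ E3).symm.toContinuousLinearEquiv.contDiff).comp_contDiffOn
    hP.fderivWithin

theorem SmoothST.sub {T : ℝ} {u v : ℝ → E3 → F} (hu : SmoothST T u) (hv : SmoothST T v) :
    SmoothST T (fun t x => u t x - v t x) := ContDiffOn.sub hu hv

theorem SmoothST.inner {T : ℝ} {u v : ℝ → E3 → E3} (hu : SmoothST T u) (hv : SmoothST T v) :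
    SmoothST T (fun t x => inner ℝ (u t x) (v t x)) := ContDiffOn.inner ℝ hu hv

theorem SmoothST.mono {T S : ℝ} (h : S ≤ T) {g : ℝ → E3 → F} (hg : SmoothST T g) :
    SmoothST S g := ContDiffOn.mono hg (prod_mono (Ico_subset_Ico_right h) subset_rfl)

theorem SmoothST.exists_bound {T S : ℝ} (hS : S < T) {g : ℝ → E3 → F} (hg : SmoothST T g) :
    ∃ C, 0 ≤ C ∧ ∀ t ∈ Icc 0 S, ∀ x ∈ cyl, ‖g t x‖ ≤ C := by
  have hc : ContinuousOn (fun z : ℝ × E3 => g z.1 z.2) (Icc 0 S ×ˢ cyl) :=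
    hg.continuousOn.mono (prod_mono (fun t ht => ⟨ht.1, ht.2.trans_lt hS⟩) subset_rfl)
  obtain ⟨C, hC⟩ := (isCompact_Icc.prod isCompact_cyl).exists_bound_of_continuousOn hc
  exact ⟨max C 0, le_max_right _ _, fun t ht x hx => (hC (t, x) ⟨ht, hx⟩).trans (le_max_left _ _)⟩

theorem SmoothST.aestronglyMeasurable {T : ℝ} {g : ℝ → E3 → F} (hg : SmoothST T g) :
    AEStronglyMeasurable (fun z : ℝ × E3 => g z.1 z.2)
      ((volume.restrict (Ioo 0 T)).prod (volume.restrict cyl)) := by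
  rw [Measure.prod_restrict]
  exact (hg.continuousOn.mono (prod_mono Ioo_subset_Ico_self subset_rfl)).aestronglyMeasurable
    (measurableSet_Ioo.prod measurableSet_cyl)

theorem pd_congr {j : Fin 3} {u w : E3 → F} (h : EqOn u w cyl) {x : E3} (hx : x ∈ cyl) :
    pd j u x = pd j w x := by
  simp only [SwirlNS.pd, fderivWithin_congr h (h hx)]

theorem pd_mul {j : Fin 3} {u w : E3 → ℝ} {x : E3} (hx : x ∈ cyl)
    (hu : DifferentiableWithinAt ℝ u cyl x) (hw : DifferentiableWithinAt ℝ w cyl x) :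
    pd j (fun y => u y * w y) x = u x * pd j w x + pd j u x * w x := by
  simp only [SwirlNS.pd]
  rw [fderivWithin_fun_mul (uniqueDiffOn_cyl x hx) hu hw]
  simp [mul_comm]

theorem pd_coord {j i : Fin 3} {u : E3 → E3} {x : E3} (hx : x ∈ cyl)
    (hu : DifferentiableWithinAt ℝ u cyl x) :
    pd j (fun y => u y i) x = pd j u x i := by
  simp only [SwirlNS.pd]
  have := (EuclideanSpace.proj i : E3 →L[ℝ] ℝ).hasFDerivAt.comp_hasFDerivWithinAt
    x hu.hasFDerivWithinAt
  have h2 := this.fderivWithin (uniqueDiffOn_cyl x hx)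
  have h3 : fderivWithin ℝ (fun y => u y i) cyl x = _ := h2
  rw [h3]; rfl

theorem sum_single (a : E3) : a = ∑ j, a j • EuclideanSpace.single j (1 : ℝ) := by
  ext i
  fin_cases i <;> simp [Fin.sum_univ_three]

theorem fderivWithin_apply_eq_sum (u : E3 → F) (x a : E3) :
    fderivWithin ℝ u cyl x a = ∑ j, a j • pd j u x := by
  conv_lhs => rw [sum_single a]
  simp [SwirlNS.pd, map_sum]

theorem inner_E3 (a b : E3) : inner ℝ a b = ∑ i, a i * b i := by
  simp [PiLp.inner_apply, mul_comm]

theorem gradientWithin_coord (P : E3 → ℝ) (x : E3) (i : Fin 3) :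
    gradientWithin P cyl x i = pd i P x := by
  have h := InnerProductSpace.toDual_symm_apply (𝕜 := ℝ) (x := EuclideanSpace.single i (1 : ℝ))
    (y := fderivWithin ℝ P cyl x)
  simp only [gradientWithin, SwirlNS.pd]
  rw [← h, real_inner_comm, EuclideanSpace.inner_single_left]
  simp

end smooth

/-! ### The divergence theorem on the cylinder -/

/-- The part of the boundary of the cylinder that is not parallel to the `j`-th axis. -/
def endBdry (j : Fin 3) : Set E3 := if j = 2 then horBdry else vertBdry

/-- This is all the geometry that the divergence theorem needs. Horizontal chords end on the lateral
surface, vertical ones on the two discs. -/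
theorem slice_cyl (j : Fin 3) (y : E3) (hy : y j = 0) :
    (∀ s : ℝ, y + s • EuclideanSpace.single j (1 : ℝ) ∉ cyl) ∨
    ∃ a b : ℝ, a ≤ b ∧ (∀ s : ℝ, y + s • EuclideanSpace.single j (1 : ℝ) ∈ cyl ↔ s ∈ Icc a b) ∧
      y + a • EuclideanSpace.single j (1 : ℝ) ∈ endBdry j ∧
      y + b • EuclideanSpace.single j (1 : ℝ) ∈ endBdry j := by
  have key : ∀ c : ℝ, 0 ≤ 1 - c ^ 2 → ∀ s : ℝ, s ^ 2 + c ^ 2 ≤ 1 ↔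
      s ∈ Icc (-√(1 - c ^ 2)) (√(1 - c ^ 2)) := by
    intro c hc s
    rw [mem_Icc, ← abs_le, ← Real.sqrt_sq_eq_abs, Real.sqrt_le_sqrt_iff hc]
    constructor <;> intro <;> linarith
  fin_cases j
  · simp only [Fin.zero_eta] at hy ⊢
    by_cases h : 0 ≤ 1 - y 1 ^ 2 ∧ 0 ≤ y 2 ∧ y 2 ≤ 1
    · refine Or.inr ⟨-√(1 - y 1 ^ 2), √(1 - y 1 ^ 2), ?_, fun s => ?_, ?_, ?_⟩
      · linarith [Real.sqrt_nonneg (1 - y 1 ^ 2)]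
      · rw [← key _ h.1]; simp [cyl, hy, h]
      · simp [endBdry, vertBdry, hy, h, Real.sq_sqrt h.1]
      · simp [endBdry, vertBdry, hy, h, Real.sq_sqrt h.1]
    · refine Or.inl fun s hs => h ?_
      simp [cyl, hy] at hs
      exact ⟨by nlinarith [hs.1, sq_nonneg s], hs.2⟩
  · simp only [Fin.mk_one] at hy ⊢
    by_cases h : 0 ≤ 1 - y 0 ^ 2 ∧ 0 ≤ y 2 ∧ y 2 ≤ 1
    · refine Or.inr ⟨-√(1 - y 0 ^ 2), √(1 - y 0 ^ 2), ?_, fun s => ?_, ?_, ?_⟩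
      · linarith [Real.sqrt_nonneg (1 - y 0 ^ 2)]
      · rw [← key _ h.1]; simp [cyl, hy, h, add_comm]
      · simp [endBdry, vertBdry, hy, h, Real.sq_sqrt h.1]
      · simp [endBdry, vertBdry, hy, h, Real.sq_sqrt h.1]
    · refine Or.inl fun s hs => h ?_
      simp [cyl, hy] at hs
      exact ⟨by nlinarith [hs.1, sq_nonneg s], hs.2⟩
  · simp only [Fin.reduceFinMk] at hy ⊢
    by_cases h : y 0 ^ 2 + y 1 ^ 2 ≤ 1
    · refine Or.inr ⟨0, 1, zero_le_one, fun s => ?_, ?_, ?_⟩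
      · simp [cyl, hy, h]
      · simp [endBdry, horBdry, hy, h]
      · simp [endBdry, horBdry, hy, h]
    · refine Or.inl fun s hs => h ?_
      simp [cyl, hy] at hs
      exact hs.1

/-- The splitting of `E3` into the `j`-th coordinate and the other two. -/
def splitAt (j : Fin 3) : E3 ≃ᵐ ℝ × (Fin 2 → ℝ) :=
  (MeasurableEquiv.toLp 2 (Fin 3 → ℝ)).symm.trans
    (MeasurableEquiv.piFinSuccAbove (fun _ : Fin 3 => ℝ) j)

theorem measurePreserving_splitAt (j : Fin 3) : MeasurePreserving (splitAt j) :=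
  (EuclideanSpace.volume_preserving_symm_measurableEquiv_toLp (Fin 3)).trans
    (volume_preserving_piFinSuccAbove (fun _ : Fin 3 => ℝ) j)

theorem splitAt_symm_apply (j : Fin 3) (s : ℝ) (c : Fin 2 → ℝ) :
    (splitAt j).symm (s, c) = (splitAt j).symm (0, c) + s • EuclideanSpace.single j (1 : ℝ) := by
  have h : ∀ s, (splitAt j).symm (s, c) = WithLp.toLp 2 (j.insertNth s c : Fin 3 → ℝ) :=
    fun _ => rfl
  rw [h, h]
  ext i
  refine Fin.succAboveCases j ?_ (fun i => ?_) i <;> simp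

theorem splitAt_symm_zero (j : Fin 3) (c : Fin 2 → ℝ) : (splitAt j).symm (0, c) j = 0 := by
  have h : (splitAt j).symm (0, c) = WithLp.toLp 2 (j.insertNth 0 c : Fin 3 → ℝ) := rfl
  rw [h]; simp

/-- Fubini in the j-th direction and the fundamental theorem of calculus on each chord; neither
surface measure nor normals appear. -/
theorem integral_pd_eq_zero (j : Fin 3) {u : E3 → ℝ} (hu : ContDiffOn ℝ 1 u cyl)
    (hb : ∀ x ∈ endBdry j, u x = 0) : ∫ x in cyl, pd j u x = 0 := by
  have hcont : ContinuousOn (pd j u) cyl :=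
    (hu.continuousOn_fderivWithin uniqueDiffOn_cyl le_rfl).clm_apply continuousOn_const
  have hint : IntegrableOn (pd j u) cyl := hcont.integrableOn_compact isCompact_cyl
  have mp := measurePreserving_splitAt j
  rw [← integral_indicator measurableSet_cyl, ← mp.symm.integral_comp',
    show (volume : Measure (ℝ × (Fin 2 → ℝ))) = volume.prod volume from rfl, integral_prod_symm]
  swap
  · exact (mp.symm.integrable_comp_emb (splitAt j).symm.measurableEmbedding).2
      ((integrable_indicator_iff measurableSet_cyl).2 hint)
  refine integral_eq_zero_of_ae (Eventually.of_forall fun c => ?_)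
  obtain ⟨y, hy0, hy⟩ : ∃ y : E3, y j = 0 ∧
      ∀ s, (splitAt j).symm (s, c) = y + s • EuclideanSpace.single j (1 : ℝ) :=
    ⟨_, splitAt_symm_zero j c, fun s => splitAt_symm_apply j s c⟩
  simp only [hy, Pi.zero_apply]
  rcases slice_cyl j y hy0 with h | ⟨a, b, hab, hm, ha, hb'⟩
  · simp [indicator_of_notMem (h _)]
  have e1 : (fun s : ℝ => cyl.indicator (pd j u) (y + s • EuclideanSpace.single j (1 : ℝ))) =
      (Icc a b).indicator fun s => pd j u (y + s • EuclideanSpace.single j (1 : ℝ)) := by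
    ext s
    by_cases hs : s ∈ Icc a b
    · rw [indicator_of_mem hs, indicator_of_mem ((hm s).2 hs)]
    · rw [indicator_of_notMem hs, indicator_of_notMem (fun h => hs ((hm s).1 h))]
  rw [e1, integral_indicator measurableSet_Icc, integral_Icc_eq_integral_Ioc,
    ← intervalIntegral.integral_of_le hab]
  have hline : Continuous fun s : ℝ => y + s • EuclideanSpace.single j (1 : ℝ) := by fun_prop
  have hmaps : MapsTo (fun s : ℝ => y + s • EuclideanSpace.single j (1 : ℝ)) (Icc a b) cyl :=
    fun s hs => (hm s).2 hs
  rw [intervalIntegral.integral_eq_sub_of_hasDerivAt_of_le hab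
    (f := fun s => u (y + s • EuclideanSpace.single j (1 : ℝ)))]
  · rw [hb _ ha, hb _ hb', sub_zero]
  · exact hu.continuousOn.comp hline.continuousOn hmaps
  -- A chord may lie in the boundary of the cylinder, so u is differentiable only within `cyl`.
  -- Along the open chord this is nevertheless an ordinary derivative in s.
  · intro s hs
    have hl : HasDerivAt (fun s : ℝ => y + s • EuclideanSpace.single j (1 : ℝ))
        (EuclideanSpace.single j (1 : ℝ)) s := by
      simpa using ((hasDerivAt_id s).smul_const (EuclideanSpace.single j (1 : ℝ))).const_add y
    have hd := ((hu.differentiableOn one_ne_zero) _ (hmaps (Ioo_subset_Icc_self hs))).hasFDerivWithinAt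
    exact (hd.comp_hasDerivWithinAt s hl.hasDerivWithinAt hmaps).hasDerivAt
      (Icc_mem_nhds hs.1 hs.2)
  · exact ContinuousOn.intervalIntegrable_of_Icc hab (hcont.comp hline.continuousOn hmaps)

theorem integral_mul_pd_eq_neg (j : Fin 3) {u w : E3 → ℝ} (hu : ContDiffOn ℝ 1 u cyl)
    (hw : ContDiffOn ℝ 1 w cyl) (hb : ∀ x ∈ endBdry j, u x = 0 ∨ w x = 0) :
    ∫ x in cyl, u x * pd j w x = -∫ x in cyl, pd j u x * w x := by
  have h := integral_pd_eq_zero j (hu.mul hw) fun x hx => mul_eq_zero.2 (hb x hx)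
  have hc : ∀ {g : E3 → ℝ}, ContDiffOn ℝ 1 g cyl → ContinuousOn (pd j g) cyl := fun hg =>
    (hg.continuousOn_fderivWithin uniqueDiffOn_cyl le_rfl).clm_apply continuousOn_const
  have i1 : IntegrableOn (fun x => u x * pd j w x) cyl :=
    (hu.continuousOn.mul (hc hw)).integrableOn_compact isCompact_cyl
  have i2 : IntegrableOn (fun x => pd j u x * w x) cyl :=
    ((hc hu).mul hw.continuousOn).integrableOn_compact isCompact_cyl
  rw [setIntegral_congr_fun measurableSet_cyl fun x hx =>
    pd_mul hx (hu.differentiableOn one_ne_zero x hx) (hw.differentiableOn one_ne_zero x hx),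
    integral_add i1 i2] at h
  exact eq_neg_of_add_eq_zero_left h

/-- The boundary term of the j-th integration lives on `endBdry j`. The no-slip condition removes it
on the lateral surface; on the discs either u₃ = 0 or the test function vanishes. -/
theorem isWeakGradBC_of_smooth {u : E3 → E3} (hu : ContDiffOn ℝ ∞ u cyl) (h0 : NoSlipVert u)
    (h2 : ∀ x ∈ horBdry, u x 2 = 0) : IsWeakGradBC u (fun j => pd j u) := by
  intro i j ψ hψ hb
  have hui : ContDiffOn ℝ ∞ (fun x => u x i) cyl := contDiffOn_euclidean.1 hu i
  rw [integral_mul_pd_eq_neg j (hui.of_le (by simp)) (hψ.of_le (by simp))]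
  · congr 1
    refine setIntegral_congr_fun measurableSet_cyl fun x hx => ?_
    simp only [pd_coord hx (hu.differentiableOn (by simp) x hx)]
  · intro x hx
    unfold endBdry at hx
    split_ifs at hx with hj
    · by_cases hi : i = 2
      · subst hi; exact Or.inl (h2 x hx)
      · exact Or.inr (hb hi hj x hx)
    · exact Or.inl (by simp [h0 x hx])

/-! ### Classical solutions are weak solutions -/

theorem MemLp.integrable_cyl {F : Type*} [NormedAddCommGroup F] {u : E3 → F}
    (hu : MemLp u 2 (volume.restrict cyl)) : IntegrableOn u cyl := hu.integrable (by norm_num)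

theorem MemLp.coord_cyl {u : E3 → E3} (hu : MemLp u 2 (volume.restrict cyl)) (i : Fin 3) :
    IntegrableOn (fun x => u x i) cyl :=
  (EuclideanSpace.proj i : E3 →L[ℝ] ℝ).integrable_comp (MemLp.integrable_cyl hu)

theorem integrableOn_inner_cyl {u g : E3 → E3} (hu : MemLp u 2 (volume.restrict cyl))
    (hg : ContinuousOn g cyl) : IntegrableOn (fun x => inner ℝ (u x) (g x)) cyl := by
  simp only [inner_E3]
  refine integrable_finsetSum _ fun i _ => ?_
  exact (MemLp.coord_cyl hu i).mul_continuousOn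
    ((EuclideanSpace.proj i : E3 →L[ℝ] ℝ).continuous.comp_continuousOn hg) isCompact_cyl

theorem ContinuousOn.memLp_cyl {F : Type*} [NormedAddCommGroup F] {u : E3 → F}
    (hu : ContinuousOn u cyl) (p : ℝ≥0∞) : MemLp u p (volume.restrict cyl) := by
  obtain ⟨C, hC⟩ := isCompact_cyl.exists_bound_of_continuousOn hu
  exact MemLp.of_bound (hu.aestronglyMeasurable_of_isCompact isCompact_cyl measurableSet_cyl) C
    ((ae_restrict_iff' measurableSet_cyl).2 (Eventually.of_forall hC))

/-- A weakly divergence free field tangential to the boundary is orthogonal to gradients. -/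
theorem IsWeakGradBC.integral_fderivWithin_eq_zero {u : E3 → E3} {G : Fin 3 → E3 → E3}
    (hu : MemLp u 2 (volume.restrict cyl)) (hG : ∀ j, MemLp (G j) 2 (volume.restrict cyl))
    (h : IsWeakGradBC u G) (htr : ∀ᵐ x ∂(volume.restrict cyl), ∑ j, G j x j = 0)
    {ψ : E3 → ℝ} (hψ : ContDiffOn ℝ ∞ ψ cyl) :
    ∫ x in cyl, fderivWithin ℝ ψ cyl x (u x) = 0 := by
  simp only [fderivWithin_apply_eq_sum, smul_eq_mul]
  have hpd : ∀ j, ContinuousOn (pd j ψ) cyl := fun j =>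
    (hψ.continuousOn_fderivWithin uniqueDiffOn_cyl (by simp)).clm_apply continuousOn_const
  -- Only the diagonal pairs (u_j, ∂_j) occur, and for these ψ is not required to vanish anywhere.
  -- This is what allows an arbitrary pressure.
  rw [integral_finsetSum _ fun j _ => (MemLp.coord_cyl hu j).mul_continuousOn (hpd j) isCompact_cyl,
    Finset.sum_congr rfl fun j _ => h j j ψ hψ fun h1 h2 => absurd h2 h1, Finset.sum_neg_distrib,
    ← integral_finsetSum _ fun j _ =>
      (MemLp.coord_cyl (hG j) j).mul_continuousOn hψ.continuousOn isCompact_cyl, neg_eq_zero]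
  refine integral_eq_zero_of_ae ?_
  filter_upwards [htr] with x hx
  rw [← Finset.sum_mul, hx, zero_mul, Pi.zero_apply]

theorem IsClassicalSolution.smooth_force {T : ℝ} {f v : ℝ → E3 → E3}
    (h : IsClassicalSolution T f v) : SmoothST T f := by
  obtain ⟨hv, ⟨P, hP, he⟩, -⟩ := h
  have : SmoothST T fun t x => lap (v t) x - convect (v t) (v t) x - gradientWithin (P t) cyl x
      - dt T v t x := ((hv.lap.sub (hv.convect hv)).sub hP.gradient).sub hv.dt
  exact ContDiffOn.congr this fun z hz => (he z.1 hz.1 z.2 hz.2).symm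

theorem IsClassicalSolution.mono {T S : ℝ} (hS : S ≤ T) {f v : ℝ → E3 → E3}
    (h : IsClassicalSolution T f v) : IsClassicalSolution S f v := by
  obtain ⟨hv, ⟨P, hP, he⟩, hd, hn, hs⟩ := h
  have hsub : Ico 0 S ⊆ Ico 0 T := Ico_subset_Ico_right hS
  refine ⟨hv.mono hS, ⟨P, hP.mono hS, fun t ht x hx => ?_⟩, fun t ht => hd t (hsub ht),
    fun t ht => hn t (hsub ht), fun t ht => hs t (hsub ht)⟩
  rw [← he t (hsub ht) x hx]
  congr 1
  simp only [dt]
  exact derivWithin_subset hsub (uniqueDiffOn_Ico_zero S t ht)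
    ((hv.timeSlice hx).differentiableOn (by simp) t (hsub ht))

/-- The equation of a classical solution, tested with a weakly differentiable field. -/
theorem IsClassicalSolution.integral_inner_dt {T : ℝ} {f v : ℝ → E3 → E3}
    (hcl : IsClassicalSolution T f v) {t : ℝ} (ht : t ∈ Ico 0 T)
    {u : E3 → E3} {G : Fin 3 → E3 → E3}
    (hu : MemLp u 2 (volume.restrict cyl)) (hG : ∀ j, MemLp (G j) 2 (volume.restrict cyl))
    (h : IsWeakGradBC u G) (htr : ∀ᵐ x ∂(volume.restrict cyl), ∑ j, G j x j = 0) :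
    ∫ x in cyl, inner ℝ (u x) (dt T v t x) =
      -(∫ x in cyl, ∑ j, inner ℝ (G j x) (pd j (v t) x))
        - (∫ x in cyl, inner ℝ (u x) (convect (v t) (v t) x))
        - ∫ x in cyl, inner ℝ (f t x) (u x) := by
  have hf := hcl.smooth_force
  obtain ⟨hv, ⟨P, hP, he⟩, -, -, hsl⟩ := hcl
  have hP0 := h.integral_fderivWithin_eq_zero hu hG htr (hP.slice ht)
  have hpd := fun j => ((hv.pd j).slice ht)
  have hlap : ∫ x in cyl, inner ℝ (u x) (lap (v t) x) =
      -(∫ x in cyl, ∑ j, inner ℝ (G j x) (pd j (v t) x)) := by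
    have e1 : ∀ x ∈ cyl, inner ℝ (u x) (lap (v t) x) =
        ∑ j, ∑ i, u x i * pd j (fun y => pd j (v t) y i) x := by
      intro x hx
      simp only [lap, inner_sum, inner_E3]
      refine Finset.sum_congr rfl fun j _ => Finset.sum_congr rfl fun i _ => ?_
      rw [pd_coord hx ((hpd j).differentiableOn (by simp) x hx)]
    have hpdi : ∀ i j, ContDiffOn ℝ ∞ (fun x => pd j (v t) x i) cyl :=
      fun i j => contDiffOn_euclidean.1 (hpd j) i
    have hc2 : ∀ i j, ContinuousOn (pd j (fun y => pd j (v t) y i)) cyl := fun i j =>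
      ((hpdi i j).continuousOn_fderivWithin uniqueDiffOn_cyl (by simp)).clm_apply continuousOn_const
    rw [setIntegral_congr_fun measurableSet_cyl e1,
      integral_finsetSum _ fun j _ => integrable_finsetSum _ fun i _ =>
        (MemLp.coord_cyl hu i).mul_continuousOn (hc2 i j) isCompact_cyl,
      integral_finsetSum _ fun j _ => integrableOn_inner_cyl (hG j) (hpd j).continuousOn,
      ← Finset.sum_neg_distrib]
    refine Finset.sum_congr rfl fun j _ => ?_
    simp only [inner_E3]
    rw [integral_finsetSum _ fun i _ =>
        (MemLp.coord_cyl hu i).mul_continuousOn (hc2 i j) isCompact_cyl,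
      integral_finsetSum _ fun i _ =>
        (MemLp.coord_cyl (hG j) i).mul_continuousOn (hpdi i j).continuousOn isCompact_cyl,
      ← Finset.sum_neg_distrib]
    refine Finset.sum_congr rfl fun i _ => h i j _ (hpdi i j) ?_
    -- The test function is ∂₃vᵢ with i ≠ 3, and the requirement that it vanish on the horizontal
    -- boundary is exactly the total slip condition.
    rintro hi rfl x hx
    obtain ⟨-, h0, h1⟩ := hsl t ht x hx
    fin_cases i
    · exact h0
    · exact h1
    · exact absurd rfl hi
  have hgr : ∀ x, inner ℝ (u x) (gradientWithin (P t) cyl x) = fderivWithin ℝ (P t) cyl x (u x) := by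
    intro x
    simp only [fderivWithin_apply_eq_sum, inner_E3, gradientWithin_coord, smul_eq_mul]
  have e2 : ∀ x ∈ cyl, inner ℝ (u x) (dt T v t x) = inner ℝ (u x) (lap (v t) x)
      - inner ℝ (u x) (convect (v t) (v t) x) - inner ℝ (u x) (gradientWithin (P t) cyl x)
      - inner ℝ (u x) (f t x) := by
    intro x hx
    rw [← he t ht x hx]
    simp only [inner_sub_right]
    ring
  have i1 := integrableOn_inner_cyl hu (hv.lap.slice ht).continuousOn
  have i2 := integrableOn_inner_cyl hu ((hv.convect hv).slice ht).continuousOn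
  have i3 := integrableOn_inner_cyl hu (hP.gradient.slice ht).continuousOn
  have i4 := integrableOn_inner_cyl hu (hf.slice ht).continuousOn
  rw [setIntegral_congr_fun measurableSet_cyl e2, integral_sub ((i1.fun_sub i2).fun_sub i3) i4,
    integral_sub (i1.fun_sub i2) i3, integral_sub i1 i2, hlap]
  simp only [hgr, hP0, real_inner_comm, sub_zero]

/-- Fundamental theorem of calculus in time at each x, then Fubini. The interval [0,t] is compact in
[0,T), so the behaviour near T plays no role. -/
theorem integral_sub_eq_integral_derivWithin {T : ℝ} {g : ℝ → E3 → ℝ} (hg : SmoothST T g) {t : ℝ}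
    (ht : t ∈ Ico 0 T) :
    (∫ x in cyl, g t x) - ∫ x in cyl, g 0 x =
      ∫ s in Ioo 0 t, ∫ x in cyl, derivWithin (fun r => g r x) (Ico 0 T) s := by
  have h0 : (0 : ℝ) ∈ Ico 0 T := ⟨le_rfl, ht.1.trans_lt ht.2⟩
  have hsub : Icc 0 t ⊆ Ico 0 T := fun s hs => ⟨hs.1, hs.2.trans_lt ht.2⟩
  have hint : Integrable (fun z : ℝ × E3 => derivWithin (fun r => g r z.2) (Ico 0 T) z.1)
      ((volume.restrict (Ioo 0 t)).prod (volume.restrict cyl)) := by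
    rw [Measure.prod_restrict]
    have := (hg.derivTime.continuousOn.mono (prod_mono hsub subset_rfl)).integrableOn_compact
      (isCompact_Icc.prod isCompact_cyl) (μ := volume)
    exact this.mono_set (prod_mono Ioo_subset_Icc_self subset_rfl)
  rw [← integral_sub ((hg.slice ht).continuousOn.integrableOn_compact isCompact_cyl)
    ((hg.slice h0).continuousOn.integrableOn_compact isCompact_cyl),
    integral_integral_swap hint]
  refine setIntegral_congr_fun measurableSet_cyl fun x hx => ?_
  rw [← integral_Ioc_eq_integral_Ioo, ← intervalIntegral.integral_of_le ht.1]
  have hs := hg.timeSlice hx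
  refine (intervalIntegral.integral_eq_sub_of_hasDerivAt_of_le ht.1
    (hs.continuousOn.mono hsub) (fun s hs' => ?_) ?_).symm
  · have hI : Ico 0 T ∈ 𝓝 s := Ico_mem_nhds hs'.1 (hs'.2.trans ht.2)
    exact ((hs.differentiableOn (by simp)) s (hsub (Ioo_subset_Icc_self hs'))).hasDerivWithinAt.hasDerivAt hI
  · exact ContinuousOn.intervalIntegrable_of_Icc ht.1
      ((hg.derivTime.timeSlice hx).continuousOn.mono hsub)

theorem derivWithin_inner {T : ℝ} {u v : ℝ → E3 → E3} (hu : SmoothST T u) (hv : SmoothST T v)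
    {t : ℝ} (ht : t ∈ Ico 0 T) {x : E3} (hx : x ∈ cyl) :
    derivWithin (fun r => inner ℝ (u r x) (v r x)) (Ico 0 T) t =
      inner ℝ (u t x) (dt T v t x) + inner ℝ (dt T u t x) (v t x) :=
  ((hu.timeSlice hx).differentiableOn (by simp) t ht).hasDerivWithinAt.inner ℝ
    ((hv.timeSlice hx).differentiableOn (by simp) t ht).hasDerivWithinAt |>.derivWithin
    (uniqueDiffOn_Ico_zero T t ht)

theorem fderivWithin_inner_cyl {u v : E3 → E3} (hu : ContDiffOn ℝ ∞ u cyl)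
    (hv : ContDiffOn ℝ ∞ v cyl) {x : E3} (hx : x ∈ cyl) (a : E3) :
    fderivWithin ℝ (fun y => inner ℝ (u y) (v y)) cyl x a =
      inner ℝ (u x) (fderivWithin ℝ v cyl x a) + inner ℝ (fderivWithin ℝ u cyl x a) (v x) := by
  rw [((hu.differentiableOn (by simp) x hx).hasFDerivWithinAt.inner ℝ
    (hv.differentiableOn (by simp) x hx).hasFDerivWithinAt).fderivWithin (uniqueDiffOn_cyl x hx)]
  simp [fderivInnerCLM_apply]

section
variable {T : ℝ} {f v : ℝ → E3 → E3}

theorem IsClassicalSolution.isWeakGradBC (h : IsClassicalSolution T f v) {t : ℝ}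
    (ht : t ∈ Ico 0 T) : IsWeakGradBC (v t) (fun j => pd j (v t)) :=
  isWeakGradBC_of_smooth (h.1.slice ht) (h.2.2.2.1 t ht) fun x hx => (h.2.2.2.2 t ht x hx).1

theorem IsClassicalSolution.trace_eq_zero (h : IsClassicalSolution T f v) {t : ℝ}
    (ht : t ∈ Ico 0 T) : ∀ᵐ x ∂(volume.restrict cyl), ∑ j, pd j (v t) x j = 0 :=
  (ae_restrict_iff' measurableSet_cyl).2 (Eventually.of_forall fun x hx => h.2.2.1 t ht x hx)

theorem SmoothST.memLp_slice {F : Type*} [NormedAddCommGroup F] [NormedSpace ℝ F]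
    {g : ℝ → E3 → F} (hg : SmoothST T g) {t : ℝ}
    (ht : t ∈ Ico 0 T) : MemLp (g t) 2 (volume.restrict cyl) :=
  ContinuousOn.memLp_cyl (hg.slice ht).continuousOn 2

/-- The field v is orthogonal to the gradient of u·v, so transport by v is antisymmetric. -/
theorem IsClassicalSolution.integral_convect (h : IsClassicalSolution T f v) {t : ℝ}
    (ht : t ∈ Ico 0 T) {u : E3 → E3} (hu : ContDiffOn ℝ ∞ u cyl) :
    ∫ x in cyl, inner ℝ (u x) (convect (v t) (v t) x) =
      -∫ x in cyl, inner ℝ (v t x) (convect (v t) u x) := by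
  have hv := h.1.slice ht
  have h0 := (h.isWeakGradBC ht).integral_fderivWithin_eq_zero (h.1.memLp_slice ht)
    (fun j => (h.1.pd j).memLp_slice ht) (h.trace_eq_zero ht) (hu.inner ℝ hv)
  have hc : ∀ {w : E3 → E3}, ContDiffOn ℝ ∞ w cyl →
      ContinuousOn (fun x => fderivWithin ℝ w cyl x (v t x)) cyl := fun hw =>
    (hw.continuousOn_fderivWithin uniqueDiffOn_cyl (by simp)).clm_apply hv.continuousOn
  have i1 : IntegrableOn (fun x => inner ℝ (u x) (fderivWithin ℝ (v t) cyl x (v t x))) cyl :=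
    (hu.continuousOn.inner (hc hv)).integrableOn_compact isCompact_cyl
  have i2 : IntegrableOn (fun x => inner ℝ (fderivWithin ℝ u cyl x (v t x)) (v t x)) cyl :=
    ((hc hu).inner hv.continuousOn).integrableOn_compact isCompact_cyl
  rw [setIntegral_congr_fun measurableSet_cyl fun x hx =>
    fderivWithin_inner_cyl hu hv hx (v t x), integral_add i1 i2] at h0
  simp only [convect, real_inner_comm] at h0 ⊢
  linarith

theorem IsClassicalSolution.integral_convect_self (h : IsClassicalSolution T f v) {t : ℝ}
    (ht : t ∈ Ico 0 T) : ∫ x in cyl, inner ℝ (v t x) (convect (v t) (v t) x) = 0 := by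
  have := h.integral_convect ht (h.1.slice ht)
  linarith

/-- The equation is tested with v itself; antisymmetry removes the convection term. -/
theorem IsClassicalSolution.energy_eq (h : IsClassicalSolution T f v) {t : ℝ}
    (ht : t ∈ Ico 0 T) :
    (1 / 2) * (∫ x in cyl, ‖v t x‖ ^ 2) + ∫ s in Ioo 0 t, ∫ x in cyl, ∑ j, ‖pd j (v s) x‖ ^ 2
      = (1 / 2) * (∫ x in cyl, ‖v 0 x‖ ^ 2) - ∫ s in Ioo 0 t, ∫ x in cyl, inner ℝ (f s x) (v s x) := by
  have hsub : Ioo 0 t ⊆ Ico 0 T := fun s hs => ⟨hs.1.le, hs.2.trans ht.2⟩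
  have hT := integral_sub_eq_integral_derivWithin (h.1.inner h.1) ht
  have e : ∀ s ∈ Ioo 0 t, ∫ x in cyl, derivWithin (fun r => inner ℝ (v r x) (v r x)) (Ico 0 T) s =
      2 * (-(∫ x in cyl, ∑ j, ‖pd j (v s) x‖ ^ 2) - ∫ x in cyl, inner ℝ (f s x) (v s x)) := by
    intro s hs
    have hW := h.integral_inner_dt (hsub hs) (h.1.memLp_slice (hsub hs))
      (fun j => (h.1.pd j).memLp_slice (hsub hs)) (h.isWeakGradBC (hsub hs))
      (h.trace_eq_zero (hsub hs))
    rw [h.integral_convect_self (hsub hs), sub_zero] at hW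
    simp only [real_inner_self_eq_norm_sq] at hW
    rw [← hW, ← integral_const_mul]
    refine setIntegral_congr_fun measurableSet_cyl fun x hx => ?_
    rw [derivWithin_inner h.1 h.1 (hsub hs) hx, real_inner_comm (v s x) (dt T v s x)]
    ring
  have hc : ∀ {g : ℝ → E3 → ℝ}, SmoothST T g →
      IntegrableOn (fun s => ∫ x in cyl, g s x) (Ioo 0 t) := by
    intro g hg
    have : Integrable (fun z : ℝ × E3 => g z.1 z.2)
        ((volume.restrict (Ioo 0 t)).prod (volume.restrict cyl)) := by
      rw [Measure.prod_restrict]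
      exact ((hg.continuousOn.mono (prod_mono (fun s hs => ⟨hs.1, hs.2.trans_lt ht.2⟩)
        subset_rfl)).integrableOn_compact
        (isCompact_Icc.prod isCompact_cyl) (μ := volume)).mono_set
        (prod_mono Ioo_subset_Icc_self subset_rfl)
    exact this.integral_prod_left
  have s1 : SmoothST T fun s x => ∑ j, ‖pd j (v s) x‖ ^ 2 :=
    ContDiffOn.sum fun j _ => ContDiffOn.norm_sq ℝ (h.1.pd j)
  rw [setIntegral_congr_fun measurableSet_Ioo e, integral_const_mul,
    integral_sub (hc s1).fun_neg (hc (h.smooth_force.inner h.1)), integral_neg] at hT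
  simp only [real_inner_self_eq_norm_sq] at hT
  linarith

theorem IsTestField.eventually_zero {ψ : ℝ → E3 → E3} {S : ℝ}
    (hz : ∀ t ∈ Ico S T, ∀ x ∈ cyl, ψ t x = 0) {t : ℝ} (ht : t ∈ Ioo S T) {x : E3}
    (hx : x ∈ cyl) : dt T ψ t x = 0 ∧ fderivWithin ℝ (ψ t) cyl x = 0 ∧ ψ t x = 0 := by
  refine ⟨?_, ?_, hz t ⟨ht.1.le, ht.2⟩ x hx⟩
  · have : (fun r => ψ r x) =ᶠ[𝓝[Ico 0 T] t] fun _ => 0 := by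
      refine mem_nhdsWithin_of_mem_nhds ?_
      filter_upwards [Ioo_mem_nhds ht.1 ht.2] with r hr using hz r ⟨hr.1.le, hr.2⟩ x hx
    rw [dt, this.derivWithin_eq (hz t ⟨ht.1.le, ht.2⟩ x hx)]
    simp
  · have : EqOn (ψ t) (fun _ => 0) cyl := fun y hy => hz t ⟨ht.1.le, ht.2⟩ y hy
    rw [fderivWithin_congr this (this hx)]
    simp

theorem IsClassicalSolution.weak_formulation (hT : 0 < T) (h : IsClassicalSolution T f v)
    {ψ : ℝ → E3 → E3} (hψ : IsTestField T ψ) :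
    (∫ t in Ioo 0 T, ∫ x in cyl,
        (inner ℝ (v t x) (dt T ψ t x) + inner ℝ (v t x) (convect (v t) (ψ t) x)
          - ∑ j, inner ℝ (pd j (v t) x) (pd j (ψ t) x) - inner ℝ (f t x) (ψ t x)))
        + ∫ x in cyl, inner ℝ (v 0 x) (ψ 0 x) = 0 := by
  obtain ⟨hs, ⟨S, hST, hz⟩, hdiv, hns, htan⟩ := hψ
  -- The integration by parts in time stops at a t < T beyond which ψ vanishes. The number S may be
  -- negative, hence the maximum with 0.
  obtain ⟨t, htS, htT⟩ := exists_between (max_lt hST hT)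
  have ht : t ∈ Ico 0 T := ⟨(le_max_right _ _).trans htS.le, htT⟩
  have hSt : S < t := (le_max_left _ _).trans_lt htS
  have hsub : Ioo 0 t ⊆ Ico 0 T := fun s hs => ⟨hs.1.le, hs.2.trans ht.2⟩
  have hTI := integral_sub_eq_integral_derivWithin (h.1.inner hs) ht
  have e0 : ∫ x in cyl, inner ℝ (v t x) (ψ t x) = 0 := by
    refine setIntegral_eq_zero_of_forall_eq_zero fun x hx => ?_
    simp [hz t ⟨hSt.le, htT⟩ x hx]
  rw [e0, zero_sub] at hTI
  rw [setIntegral_eq_of_subset_of_forall_sdiff_eq_zero (s := Ioo 0 t) measurableSet_Ioo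
    (Ioo_subset_Ioo_right htT.le), ← neg_eq_iff_add_eq_zero, eq_comm, ← neg_eq_iff_eq_neg, hTI,
    eq_comm]
  · refine setIntegral_congr_fun measurableSet_Ioo fun s hs' => ?_
    have hs0 := hsub hs'
    have hW := h.integral_inner_dt hs0 (hs.memLp_slice hs0)
      (fun j => (hs.pd j).memLp_slice hs0)
      (isWeakGradBC_of_smooth (hs.slice hs0) (hns s hs0) (htan s hs0))
      ((ae_restrict_iff' measurableSet_cyl).2 (Eventually.of_forall fun x hx => hdiv s hs0 x hx))
    rw [h.integral_convect hs0 (hs.slice hs0)] at hW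
    have hci : ∀ {g : E3 → ℝ}, ContinuousOn g cyl → IntegrableOn g cyl := fun hg =>
      hg.integrableOn_compact isCompact_cyl
    have c1 := hci (h.1.inner hs.dt |>.slice hs0).continuousOn
    have c1' := hci (hs.inner h.1.dt |>.slice hs0).continuousOn
    have c2 := hci (h.1.inner (h.1.convect hs) |>.slice hs0).continuousOn
    have c3 : IntegrableOn (fun x => ∑ j, inner ℝ (pd j (v s) x) (pd j (ψ s) x)) cyl :=
      integrable_finsetSum _ fun j _ =>
        hci ((h.1.pd j).inner (hs.pd j) |>.slice hs0).continuousOn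
    have c4 := hci (h.smooth_force.inner hs |>.slice hs0).continuousOn
    have e1 : ∀ x ∈ cyl, derivWithin (fun r => inner ℝ (v r x) (ψ r x)) (Ico 0 T) s =
        inner ℝ (v s x) (dt T ψ s x) + inner ℝ (ψ s x) (dt T v s x) := fun x hx => by
      rw [derivWithin_inner h.1 hs hs0 hx, real_inner_comm (ψ s x)]
    rw [setIntegral_congr_fun measurableSet_cyl e1, integral_add c1 c1', hW,
      integral_sub ((c1.fun_add c2).fun_sub c3) c4, integral_sub (c1.fun_add c2) c3, integral_add c1 c2]
    simp only [real_inner_comm (pd _ (v s) _)]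
    ring
  · intro s hs'
    have hst : s ∈ Ioo S T := ⟨hSt.trans_le (not_lt.1 fun hlt => hs'.2 ⟨hs'.1.1, hlt⟩), hs'.1.2⟩
    refine setIntegral_eq_zero_of_forall_eq_zero fun x hx => ?_
    obtain ⟨z1, z2, z3⟩ := IsTestField.eventually_zero hz hst hx
    simp [z1, z3, convect, z2, pd]

theorem IsClassicalSolution.isLerayHopf (hT : 0 < T) (h : IsClassicalSolution T f v)
    (hv : MemLtLx T ⊤ 2 v) (hG : ∀ j, MemLtLx T 2 2 (fun t => pd j (v t))) :
    IsLerayHopf T f (v 0) v := by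
  have hsub : Ioo 0 T ⊆ Ico 0 T := Ioo_subset_Ico_self
  refine ⟨hv, fun j t => pd j (v t), hG, ?_, ?_, fun ψ hψ => h.weak_formulation hT hψ, ?_⟩
  · exact (ae_restrict_iff' measurableSet_Ioo).2 (Eventually.of_forall fun t ht =>
      h.isWeakGradBC (hsub ht))
  · exact (ae_restrict_iff' measurableSet_Ioo).2 (Eventually.of_forall fun t ht =>
      h.trace_eq_zero (hsub ht))
  · exact (ae_restrict_iff' measurableSet_Ioo).2 (Eventually.of_forall fun t ht =>
      (h.energy_eq (hsub ht)).le)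

end

/-! ### Two facts about integral inequalities and weak derivatives in time -/

/-- Gronwall for a merely integrable E. The inequality is integrated once more: with F = ∫E, which
is continuous, and H = ∫F, it gives H' = F ≤ C·H everywhere, and the classical Gronwall lemma
applies to H. -/
theorem ae_eq_zero_of_le_integral {S C : ℝ} (hC : 0 ≤ C) {E : ℝ → ℝ}
    (hE : ∀ t, 0 ≤ E t) (hint : IntegrableOn E (Ioo 0 S))
    (h : ∀ᵐ t ∂(volume.restrict (Ioo 0 S)), E t ≤ C * ∫ s in Ioo 0 t, E s) :
    ∀ᵐ t ∂(volume.restrict (Ioo 0 S)), E t = 0 := by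
  set E' := (Ioo 0 S).indicator E with hE'
  have hi' : Integrable E' := (integrable_indicator_iff measurableSet_Ioo).2 hint
  set F : ℝ → ℝ := fun t => ∫ s in (0 : ℝ)..t, E' s with hF
  have hFc : Continuous F := intervalIntegral.continuous_primitive
    (fun a b => hi'.intervalIntegrable) 0
  have hFE : ∀ t ∈ Icc 0 S, F t = ∫ s in Ioo 0 t, E s := by
    intro t ht
    rw [hF]; dsimp only
    rw [intervalIntegral.integral_of_le ht.1, integral_Ioc_eq_integral_Ioo]
    refine setIntegral_congr_fun measurableSet_Ioo fun s hs => ?_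
    exact indicator_of_mem (show s ∈ Ioo 0 S from ⟨hs.1, hs.2.trans_le ht.2⟩) E
  have hF0 : ∀ t ∈ Icc 0 S, 0 ≤ F t := fun t ht => by
    rw [hFE t ht]; exact integral_nonneg fun s => hE s
  set H : ℝ → ℝ := fun t => ∫ s in (0 : ℝ)..t, F s with hH
  have hHd : ∀ t, HasDerivAt H (F t) t := fun t =>
    intervalIntegral.integral_hasDerivAt_right (hFc.intervalIntegrable _ _)
      (hFc.stronglyMeasurableAtFilter _ _) hFc.continuousAt
  have hH0 : ∀ t ∈ Icc 0 S, 0 ≤ H t := fun t ht =>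
    intervalIntegral.integral_nonneg ht.1 fun s hs => hF0 s ⟨hs.1, hs.2.trans ht.2⟩
  have hFH : ∀ t ∈ Icc 0 S, F t ≤ C * H t := by
    intro t ht
    rw [hFE t ht, hH]; dsimp only
    rw [intervalIntegral.integral_of_le ht.1, integral_Ioc_eq_integral_Ioo, ← integral_const_mul]
    have hsub : Ioo 0 t ⊆ Ioo 0 S := Ioo_subset_Ioo_right ht.2
    refine integral_mono_ae (hint.mono_set hsub) ?_ ?_
    · exact ((hFc.const_mul C).integrableOn_Icc (a := 0) (b := t)).mono_set Ioo_subset_Icc_self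
    · filter_upwards [ae_restrict_of_ae_restrict_of_subset hsub h,
        ae_restrict_mem measurableSet_Ioo] with s hs hs'
      rw [hFE s ⟨hs'.1.le, (hs'.2.trans_le ht.2).le⟩]; exact hs
  have hz : ∀ t ∈ Icc 0 S, H t = 0 := by
    intro t ht
    have := norm_le_gronwallBound_of_norm_deriv_right_le (f := H) (f' := F) (δ := 0) (K := C)
      (ε := 0) (a := 0) (b := S) (fun t _ => (hHd t).continuousAt.continuousWithinAt)
      (fun t _ => (hHd t).hasDerivWithinAt) (by simp [hH]) (fun t ht => by
        have ht' := Ico_subset_Icc_self ht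
        rw [Real.norm_of_nonneg (hF0 t ht'), Real.norm_of_nonneg (hH0 t ht'), add_zero]
        exact hFH t ht') t ht
    rw [gronwallBound_ε0_δ0] at this
    exact norm_le_zero_iff.1 this
  filter_upwards [h, ae_restrict_mem measurableSet_Ioo] with t ht ht'
  have ht'' := Ioo_subset_Icc_self ht'
  refine le_antisymm (ht.trans ?_) (hE t)
  rw [← hFE t ht'']
  have := hFH t ht''
  rw [hz t ht'', mul_zero] at this
  exact mul_nonpos_of_nonneg_of_nonpos hC this

/-- The du Bois-Reymond lemma with an initial value. The test functions need not vanish at 0, and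
this is how c is detected. -/
theorem ae_eq_add_integral_of_weak_deriv {S c : ℝ} {a b : ℝ → ℝ}
    (ha : IntegrableOn a (Ioo 0 S)) (hb : IntegrableOn b (Ioo 0 S))
    (h : ∀ θ : ℝ → ℝ, ContDiff ℝ ∞ θ → (∃ R < S, ∀ t, R ≤ t → θ t = 0) →
      (∫ t in Ioo 0 S, (deriv θ t * a t + θ t * b t)) + c * θ 0 = 0) :
    ∀ᵐ t ∂(volume.restrict (Ioo 0 S)), a t = c + ∫ s in Ioo 0 t, b s := by
  set I : Set ℝ := Ioo 0 S
  set μ : Measure ℝ := volume.restrict I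
  set B : ℝ → ℝ := fun t => ∫ s in Ioo 0 t, b s
  have hBi : IntegrableOn B I := by
    have h1 : Integrable (fun z : ℝ × ℝ => {z : ℝ × ℝ | z.2 < z.1}.indicator
        (fun z => b z.2) z) (μ.prod μ) := by
      refine Integrable.indicator ?_ (measurableSet_lt measurable_snd measurable_fst)
      exact hb.comp_snd μ
    have h2 := h1.integral_prod_left
    refine (integrable_congr ?_).1 h2
    filter_upwards [ae_restrict_mem measurableSet_Ioo] with t ht
    have e : (fun s => {z : ℝ × ℝ | z.2 < z.1}.indicator (fun z => b z.2) (t, s)) =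
        (Iio t).indicator b := by
      ext s; simp [indicator]
    rw [e, integral_indicator measurableSet_Iio, Measure.restrict_restrict measurableSet_Iio]
    congr 2
    ext s; simp only [I, mem_inter_iff, mem_Iio, mem_Ioo]
    exact ⟨fun h => ⟨h.2.1, h.1⟩, fun h => ⟨h.2, h.1, h.2.trans ht.2⟩⟩
  have hloc : LocallyIntegrableOn (fun t => a t - (c + B t)) I :=
    (ha.sub ((integrable_const c).add hBi)).locallyIntegrableOn
  have key := isOpen_Ioo.ae_eq_zero_of_integral_contDiff_smul_eq_zero hloc (fun η hη hηc hηs => ?_)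
  · rw [ae_restrict_iff' measurableSet_Ioo]
    filter_upwards [key] with t ht htI
    linarith [ht htI]
  have hη0 : ∀ t ∉ I, η t = 0 := fun t ht => image_eq_zero_of_notMem_tsupport fun h' => ht (hηs h')
  -- The primitive of η is normalised at S, so that it vanishes near S. Its value at 0 is minus the
  -- total integral of η, which produces the constant c.
  set θ : ℝ → ℝ := fun t => ∫ s in S..t, η s with hθ
  have hηcont := hη.continuous
  have hθd : ∀ t, HasDerivAt θ (η t) t := fun t =>
    intervalIntegral.integral_hasDerivAt_right (hηcont.intervalIntegrable _ _)
      (hηcont.stronglyMeasurableAtFilter _ _) hηcont.continuousAt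
  have hder : deriv θ = η := funext fun t => (hθd t).deriv
  have hθs : ContDiff ℝ ∞ θ := by
    rw [contDiff_infty_iff_deriv, hder]
    exact ⟨fun t => (hθd t).differentiableAt, hη⟩
  have hR : ∃ R < S, ∀ t, R ≤ t → θ t = 0 := by
    obtain ⟨R, hRS, hR⟩ : ∃ R < S, ∀ t, R < t → η t = 0 := by
      by_cases hne : (tsupport η).Nonempty
      · obtain ⟨m, hm, hmax⟩ := hηc.isCompact.exists_isMaxOn hne continuousOn_id
        exact ⟨m, (hηs hm).2, fun t ht => image_eq_zero_of_notMem_tsupport fun h' =>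
          absurd (hmax h') (not_le.2 ht)⟩
      · exact ⟨S - 1, by linarith, fun t _ => image_eq_zero_of_notMem_tsupport fun h' => hne ⟨t, h'⟩⟩
    refine ⟨R, hRS, fun t ht => ?_⟩
    rw [hθ]; dsimp only
    refine (intervalIntegral.integral_congr_ae ?_).trans intervalIntegral.integral_zero
    refine Eventually.of_forall fun s hs => hR s ?_
    rcases le_total S t with h' | h'
    · rw [uIoc_of_le h'] at hs; exact hRS.trans hs.1
    · rw [uIoc_of_ge h'] at hs; exact ht.trans_lt hs.1
  have hmain := h θ hθs hR
  rw [hder] at hmain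
  obtain ⟨Cη, hCη⟩ := hηc.exists_bound_of_continuous hηcont
  have hηm : AEStronglyMeasurable η μ := hηcont.aestronglyMeasurable
  have hi1 : Integrable (fun t => η t * a t) μ := ha.bdd_mul hηm (Eventually.of_forall hCη)
  have hi2 : Integrable (fun t => η t * B t) μ := hBi.bdd_mul hηm (Eventually.of_forall hCη)
  have hi3 : Integrable η μ := (hηcont.integrable_of_hasCompactSupport hηc).integrableOn
  obtain ⟨Cθ, hCθ⟩ := isCompact_Icc.exists_bound_of_continuousOn (s := Icc 0 S)
    hθs.continuous.continuousOn
  have hi4 : Integrable (fun t => θ t * b t) μ :=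
    hb.bdd_mul hθs.continuous.aestronglyMeasurable (by
      filter_upwards [ae_restrict_mem measurableSet_Ioo] with t ht
        using hCθ t (Ioo_subset_Icc_self ht))
  have htail : ∀ s ∈ I, ∫ t in Ioo s S, η t = -θ s := by
    intro s hs
    rw [hθ]; dsimp only
    rw [intervalIntegral.integral_symm, neg_neg, intervalIntegral.integral_of_le hs.2.le,
      integral_Ioc_eq_integral_Ioo]
  have hfub : ∫ t, η t * B t ∂μ = -∫ s, θ s * b s ∂μ := by
    have h1 : Integrable (fun z : ℝ × ℝ => {z : ℝ × ℝ | z.2 < z.1}.indicator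
        (fun z => η z.1 * b z.2) z) (μ.prod μ) :=
      Integrable.indicator (hi3.mul_prod hb) (measurableSet_lt measurable_snd measurable_fst)
    have h2 := integral_integral_swap (f := fun t s => {z : ℝ × ℝ | z.2 < z.1}.indicator
        (fun z => η z.1 * b z.2) (t, s)) h1
    have e1 : ∀ t ∈ I, ∫ s, {z : ℝ × ℝ | z.2 < z.1}.indicator (fun z => η z.1 * b z.2) (t, s) ∂μ =
        η t * B t := by
      intro t ht
      have e : (fun s => {z : ℝ × ℝ | z.2 < z.1}.indicator (fun z => η z.1 * b z.2) (t, s)) =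
          (Iio t).indicator fun s => η t * b s := by
        ext s; simp [indicator]
      rw [e, integral_indicator measurableSet_Iio, Measure.restrict_restrict measurableSet_Iio,
        integral_const_mul]
      congr 3
      ext s; simp only [I, mem_inter_iff, mem_Iio, mem_Ioo]
      exact ⟨fun h => ⟨h.2.1, h.1⟩, fun h => ⟨h.2, h.1, h.2.trans ht.2⟩⟩
    have e2 : ∀ s ∈ I, ∫ t, {z : ℝ × ℝ | z.2 < z.1}.indicator (fun z => η z.1 * b z.2) (t, s) ∂μ =
        -(θ s * b s) := by
      intro s hs
      have e : (fun t => {z : ℝ × ℝ | z.2 < z.1}.indicator (fun z => η z.1 * b z.2) (t, s)) =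
          (Ioi s).indicator fun t => η t * b s := by
        ext t; simp [indicator]
      rw [e, integral_indicator measurableSet_Ioi, Measure.restrict_restrict measurableSet_Ioi,
        integral_mul_const]
      have e' : Ioi s ∩ I = Ioo s S := by
        ext t; simp only [I, mem_inter_iff, mem_Ioi, mem_Ioo]
        exact ⟨fun h => ⟨h.1, h.2.2⟩, fun h => ⟨h.1, hs.1.trans h.1, h.2⟩⟩
      rw [e', htail s hs]; ring
    rw [setIntegral_congr_fun measurableSet_Ioo e1, setIntegral_congr_fun measurableSet_Ioo e2] at h2
    rw [h2, integral_neg]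
  have htot : 0 ≤ S → ∫ t, η t ∂μ = -θ 0 := by
    intro hS
    rw [hθ]; dsimp only
    rw [intervalIntegral.integral_symm, neg_neg, intervalIntegral.integral_of_le hS,
      integral_Ioc_eq_integral_Ioo]
  have hrestr : ∫ t, η t • (a t - (c + B t)) = ∫ t, η t • (a t - (c + B t)) ∂μ := by
    refine (setIntegral_eq_integral_of_forall_compl_eq_zero fun t ht => ?_).symm
    rw [hη0 t ht, zero_smul]
  rw [hrestr]
  rcases le_total S 0 with hS | hS
  · have : μ = 0 := by simp [μ, I, Ioo_eq_empty (not_lt.2 hS)]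
    rw [this, integral_zero_measure]
  have e3 : ∀ t, η t • (a t - (c + B t)) = η t * a t - c * η t - η t * B t := fun t => by
    rw [smul_eq_mul]; ring
  simp only [e3]
  have hi5 : Integrable (fun t => η t * a t - c * η t) μ := hi1.sub (hi3.const_mul c)
  rw [integral_sub hi5 hi2, integral_sub hi1 (hi3.const_mul c),
    integral_const_mul, htot hS, hfub]
  rw [integral_add hi1 hi4] at hmain
  linarith

/-! ### Weak-strong uniqueness -/

theorem MemLtLx.memLp_of_top {F : Type*} [NormedAddCommGroup F] {T : ℝ} {g : ℝ → E3 → F}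
    (hg : MemLtLx T ⊤ 2 g) : MemLp (fun z : ℝ × E3 => g z.1 z.2) 2
      ((volume.restrict (Ioo 0 T)).prod (volume.restrict cyl)) := by
  refine ⟨hg.1, ?_⟩
  rw [eLpNorm_lt_top_iff_lintegral_rpow_enorm_lt_top two_ne_zero ENNReal.ofNat_ne_top,
    lintegral_prod _ (hg.1.enorm.pow_const _)]
  have h2 := hg.2
  rw [eLpNorm_exponent_top] at h2
  set M := eLpNormEssSup (fun t => eLpNorm (g t) 2 (volume.restrict cyl)) (volume.restrict (Ioo 0 T))
  have hle : ∀ᵐ t ∂(volume.restrict (Ioo 0 T)),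
      ∫⁻ x in cyl, ‖g t x‖ₑ ^ (2 : ℝ≥0∞).toReal ≤ M ^ (2 : ℝ) := by
    filter_upwards [enorm_ae_le_eLpNormEssSup (fun t => eLpNorm (g t) 2 (volume.restrict cyl))
      (volume.restrict (Ioo 0 T))] with t ht
    rw [enorm_eq_self, eLpNorm_eq_lintegral_rpow_enorm_toReal two_ne_zero ENNReal.ofNat_ne_top] at ht
    have := ENNReal.rpow_le_rpow ht (z := 2) zero_le_two
    rwa [← ENNReal.rpow_mul, ENNReal.toReal_ofNat, one_div_mul_cancel two_ne_zero,
      ENNReal.rpow_one] at this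
  refine (lintegral_mono_ae hle).trans_lt ?_
  rw [lintegral_const]
  refine ENNReal.mul_lt_top (ENNReal.rpow_lt_top_of_nonneg zero_le_two h2.ne) ?_
  simp

theorem MemLtLx.memLp_of_two {F : Type*} [NormedAddCommGroup F] {T : ℝ} {g : ℝ → E3 → F}
    (hg : MemLtLx T 2 2 g) : MemLp (fun z : ℝ × E3 => g z.1 z.2) 2
      ((volume.restrict (Ioo 0 T)).prod (volume.restrict cyl)) := by
  refine ⟨hg.1, ?_⟩
  have h2 := hg.2
  rw [eLpNorm_lt_top_iff_lintegral_rpow_enorm_lt_top two_ne_zero ENNReal.ofNat_ne_top] at h2 ⊢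
  rw [lintegral_prod _ (hg.1.enorm.pow_const _)]
  convert h2 using 3 with t
  rw [enorm_eq_self, eLpNorm_eq_lintegral_rpow_enorm_toReal two_ne_zero ENNReal.ofNat_ne_top,
    ← ENNReal.rpow_mul, ENNReal.toReal_ofNat, one_div_mul_cancel two_ne_zero,
    ENNReal.rpow_one]

theorem ae_memLp_slice {F : Type*} [NormedAddCommGroup F] {μ : Measure ℝ} [SFinite μ]
    {g : ℝ → E3 → F}
    (hg : MemLp (fun z : ℝ × E3 => g z.1 z.2) 2 (μ.prod (volume.restrict cyl))) :
    ∀ᵐ t ∂μ, MemLp (g t) 2 (volume.restrict cyl) := by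
  have h1 := (memLp_two_iff_integrable_sq_norm hg.1).1 hg
  filter_upwards [h1.prod_right_ae, hg.1.prodMk_left] with t h2 h3
  exact (memLp_two_iff_integrable_sq_norm h3).2 h2

section
variable {T : ℝ} {f v : ℝ → E3 → E3}

/-- The relative energy estimate at a fixed time. -/
theorem IsClassicalSolution.relative_energy (h : IsClassicalSolution T f v) {t : ℝ}
    (ht : t ∈ Ico 0 T) {u : E3 → E3} {G : Fin 3 → E3 → E3}
    (hu : MemLp u 2 (volume.restrict cyl)) (hG : ∀ j, MemLp (G j) 2 (volume.restrict cyl))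
    (hbc : IsWeakGradBC u G) (htr : ∀ᵐ x ∂(volume.restrict cyl), ∑ j, G j x j = 0)
    {K : ℝ} (hK : ∀ x ∈ cyl, ‖fderivWithin ℝ (v t) cyl x‖ ≤ K) :
    -(∫ x in cyl, ∑ j, ‖G j x‖ ^ 2) - (∫ x in cyl, inner ℝ (f t x) (u x))
      - (∫ x in cyl, ∑ j, ‖pd j (v t) x‖ ^ 2) - (∫ x in cyl, inner ℝ (f t x) (v t x))
      - (∫ x in cyl, (inner ℝ (u x) (dt T v t x) + inner ℝ (u x) (convect u (v t) x)
          - ∑ j, inner ℝ (G j x) (pd j (v t) x) - inner ℝ (f t x) (v t x)))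
      ≤ K * ∫ x in cyl, ‖u x - v t x‖ ^ 2 := by
  have hv := h.1.slice ht
  have hDv : ContinuousOn (fderivWithin ℝ (v t) cyl) cyl :=
    hv.continuousOn_fderivWithin uniqueDiffOn_cyl (by simp)
  have hfc := (h.smooth_force.slice ht).continuousOn
  have hvm := h.1.memLp_slice ht
  have hpm := fun j => (h.1.pd j).memLp_slice ht
  have hpc := fun j => ((h.1.pd j).slice ht).continuousOn
  have hz : MemLp (fun x => u x - v t x) 2 (volume.restrict cyl) := hu.sub hvm
  have hDm : AEStronglyMeasurable (fderivWithin ℝ (v t) cyl) (volume.restrict cyl) :=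
    hDv.aestronglyMeasurable measurableSet_cyl
  have hquad : ∀ {a b : E3 → E3}, MemLp a 2 (volume.restrict cyl) →
      MemLp b 2 (volume.restrict cyl) →
      IntegrableOn (fun x => inner ℝ (a x) (fderivWithin ℝ (v t) cyl x (b x))) cyl := by
    intro a b ha hb
    have hbd : MemLp (fun x => fderivWithin ℝ (v t) cyl x (b x)) 2 (volume.restrict cyl) := by
      refine MemLp.of_le_mul (c := K) hb ?_ ?_
      · exact (ContinuousLinearMap.id ℝ (E3 →L[ℝ] E3)).aestronglyMeasurable_comp₂ hDm hb.1
      · filter_upwards [ae_restrict_mem measurableSet_cyl] with x hx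
        exact ((fderivWithin ℝ (v t) cyl x).le_opNorm _).trans
          (mul_le_mul_of_nonneg_right (hK x hx) (norm_nonneg _))
    refine (ha.norm.integrable_mul hbd.norm).mono' (ha.1.inner hbd.1) (Eventually.of_forall fun x => ?_)
    exact norm_inner_le_norm _ _
  have iuD := integrableOn_inner_cyl hu (h.1.dt.slice ht).continuousOn
  have iuu := hquad hu hu
  have iuv := hquad hu hvm
  have iGp : IntegrableOn (fun x => ∑ j, inner ℝ (G j x) (pd j (v t) x)) cyl :=
    integrable_finsetSum _ fun j _ => integrableOn_inner_cyl (hG j) (hpc j)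
  have ifv : IntegrableOn (fun x => inner ℝ (f t x) (v t x)) cyl :=
    (hfc.inner hv.continuousOn).integrableOn_compact isCompact_cyl
  have iGG : IntegrableOn (fun x => ∑ j, ‖G j x‖ ^ 2) cyl :=
    integrable_finsetSum _ fun j _ => (memLp_two_iff_integrable_sq_norm (hG j).1).1 (hG j)
  have ipp : IntegrableOn (fun x => ∑ j, ‖pd j (v t) x‖ ^ 2) cyl :=
    integrable_finsetSum _ fun j _ => (memLp_two_iff_integrable_sq_norm (hpm j).1).1 (hpm j)
  have hW := h.integral_inner_dt ht hu hG hbc htr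
  have hgrad : (fun y => inner ℝ (v t y) (v t y) : E3 → ℝ) = fun y => ‖v t y‖ ^ 2 := by
    ext y; exact real_inner_self_eq_norm_sq _
  have hs : ContDiffOn ℝ ∞ (fun y => inner ℝ (v t y) (v t y) : E3 → ℝ) cyl := hv.inner ℝ hv
  have ho1 := hbc.integral_fderivWithin_eq_zero hu hG htr hs
  have e1 : ∀ x ∈ cyl, fderivWithin ℝ (fun y => inner ℝ (v t y) (v t y) : E3 → ℝ) cyl x (u x) =
      2 * inner ℝ (v t x) (fderivWithin ℝ (v t) cyl x (u x)) := fun x hx => by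
    rw [fderivWithin_inner_cyl hv hv hx, real_inner_comm (v t x)]; ring
  rw [setIntegral_congr_fun measurableSet_cyl e1, integral_const_mul] at ho1
  have ho2 : ∫ x in cyl, inner ℝ (v t x) (fderivWithin ℝ (v t) cyl x (v t x)) = 0 :=
    h.integral_convect_self ht
  -- Of the four terms of the quadratic form, the two with v in the left slot vanish, because u and
  -- v are both orthogonal to ∇|v|².
  have hmain : ∫ x in cyl, inner ℝ (u x - v t x)
      (fderivWithin ℝ (v t) cyl x (u x - v t x)) =
      (∫ x in cyl, inner ℝ (u x) (fderivWithin ℝ (v t) cyl x (u x)))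
        - ∫ x in cyl, inner ℝ (u x) (fderivWithin ℝ (v t) cyl x (v t x)) := by
    have e2 : ∀ x, inner ℝ (u x - v t x) (fderivWithin ℝ (v t) cyl x (u x - v t x)) =
        inner ℝ (u x) (fderivWithin ℝ (v t) cyl x (u x))
        - inner ℝ (u x) (fderivWithin ℝ (v t) cyl x (v t x))
        - (inner ℝ (v t x) (fderivWithin ℝ (v t) cyl x (u x))
          - inner ℝ (v t x) (fderivWithin ℝ (v t) cyl x (v t x))) := fun x => by
      rw [map_sub, inner_sub_left, inner_sub_right, inner_sub_right]
    simp only [e2]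
    rw [integral_sub (iuu.fun_sub iuv) ((hquad hvm hu).fun_sub (hquad hvm hvm)),
      integral_sub iuu iuv, integral_sub (hquad hvm hu) (hquad hvm hvm), ho2]
    linarith
  have hbound : -(∫ x in cyl, inner ℝ (u x - v t x)
      (fderivWithin ℝ (v t) cyl x (u x - v t x))) ≤ K * ∫ x in cyl, ‖u x - v t x‖ ^ 2 := by
    rw [← integral_neg, ← integral_const_mul]
    refine integral_mono_ae (hquad hz hz).neg
      (((memLp_two_iff_integrable_sq_norm hz.1).1 hz).const_mul K) ?_
    filter_upwards [ae_restrict_mem measurableSet_cyl] with x hx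
    refine (neg_le_abs _).trans ((abs_real_inner_le_norm _ _).trans ?_)
    have := ((fderivWithin ℝ (v t) cyl x).le_opNorm (u x - v t x)).trans
          (mul_le_mul_of_nonneg_right (hK x hx) (norm_nonneg _))
    nlinarith [norm_nonneg (u x - v t x)]
  have hsq : 0 ≤ (∫ x in cyl, ∑ j, ‖G j x‖ ^ 2) + (∫ x in cyl, ∑ j, ‖pd j (v t) x‖ ^ 2)
      - 2 * ∫ x in cyl, ∑ j, inner ℝ (G j x) (pd j (v t) x) := by
    rw [← integral_const_mul, ← integral_add iGG ipp,
      ← integral_sub (iGG.fun_add ipp) (iGp.const_mul 2)]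
    refine integral_nonneg fun x => ?_
    rw [Pi.zero_apply, Finset.mul_sum, ← Finset.sum_add_distrib, ← Finset.sum_sub_distrib]
    refine Finset.sum_nonneg fun j _ => ?_
    have := norm_sub_sq_real (G j x) (pd j (v t) x)
    nlinarith [sq_nonneg ‖G j x - pd j (v t) x‖]
  -- With the equation for v tested by u, the left side becomes -‖G - ∇v‖² minus the integral of
  -- (u-v)·((u-v)·∇)v. The first part has a sign, the second is bounded through K.
  simp only [convect] at hW ⊢
  rw [integral_sub ((iuD.fun_add iuu).fun_sub iGp) ifv, integral_sub (iuD.fun_add iuu) iGp,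
    integral_add iuD iuu, hW]
  linarith

/-- The field v need not vanish near T and so need not be a test field itself; a cutoff in time is
enough. -/
theorem isTestField_smul (h : IsClassicalSolution T f v) {S : ℝ} (hS : S < T) {θ : ℝ → ℝ}
    (hθ : ContDiff ℝ ∞ θ) (hz : ∀ t, S ≤ t → θ t = 0) :
    IsTestField T (fun t x => θ t • v t x) := by
  obtain ⟨hv, -, hd, hn, hs⟩ := h
  refine ⟨ContDiffOn.smul (hθ.comp_contDiffOn contDiffOn_fst) hv,
    ⟨S, hS, fun t ht x _ => by simp [hz t ht.1]⟩, fun t ht x hx => ?_, fun t ht x hx => ?_,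
    fun t ht x hx => ?_⟩
  · have := hd t ht x hx
    simp only [dvg, pd] at this ⊢
    rw [fderivWithin_fun_const_smul (uniqueDiffOn_cyl x hx) ((hv.slice ht).differentiableOn (by simp) x hx)]
    simp [← Finset.mul_sum, this]
  · simp [hn t ht x hx]
  · simp [(hs t ht x hx).1]

end

theorem integrable_inner_of_memLp_two {X : Type*} [MeasurableSpace X] {μ : Measure X} {a b : X → E3}
    (ha : MemLp a 2 μ) (hb : MemLp b 2 μ) : Integrable (fun x => inner ℝ (a x) (b x)) μ :=
  (ha.norm.integrable_mul hb.norm).mono' (ha.1.inner hb.1)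
    (Eventually.of_forall fun _ => norm_inner_le_norm _ _)

theorem SmoothST.memLp_prod {F : Type*} [NormedAddCommGroup F] [NormedSpace ℝ F] {T S : ℝ}
    (hS : S < T) {g : ℝ → E3 → F} (hg : SmoothST T g) (p : ℝ≥0∞) :
    MemLp (fun z : ℝ × E3 => g z.1 z.2) p
      ((volume.restrict (Ioo 0 S)).prod (volume.restrict cyl)) := by
  obtain ⟨C, -, hC⟩ := hg.exists_bound hS
  refine MemLp.of_bound (hg.mono hS.le).aestronglyMeasurable C ?_
  rw [Measure.prod_restrict]
  filter_upwards [ae_restrict_mem (measurableSet_Ioo.prod measurableSet_cyl)] with z hz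
    using hC z.1 (Ioo_subset_Icc_self hz.1) z.2 hz.2

theorem prod_restrict_Ioo_mono {S T : ℝ} (h : S ≤ T) :
    (volume.restrict (Ioo 0 S)).prod (volume.restrict cyl) ≤
      (volume.restrict (Ioo 0 T)).prod ((volume : Measure E3).restrict cyl) := by
  rw [Measure.prod_restrict, Measure.prod_restrict]
  exact Measure.restrict_mono (prod_mono (Ioo_subset_Ioo_right h) subset_rfl) le_rfl

section
variable {T : ℝ} {f v w : ℝ → E3 → E3}

/-- Below T the gradient of v is bounded, so v may serve as the strong solution; ‖w-v‖² is expanded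
and each of its three terms is controlled separately. -/
theorem IsClassicalSolution.ae_eq_of_isLerayHopf_of_lt (h : IsClassicalSolution T f v)
    (hw : IsLerayHopf T f (v 0) w) {S : ℝ} (hS : S < T) :
    ∀ᵐ t ∂(volume.restrict (Ioo 0 S)), ∀ᵐ x ∂(volume.restrict cyl), w t x = v t x := by
  obtain ⟨hw2, G, hG2, hbc, htr, hweak, hen⟩ := hw
  have hsub : Ioo 0 S ⊆ Ioo 0 T := Ioo_subset_Ioo_right hS.le
  have hsub' : Ioo 0 S ⊆ Ico 0 T := fun t ht => ⟨ht.1.le, ht.2.trans hS⟩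
  set ν := (volume.restrict (Ioo 0 S)).prod ((volume : Measure E3).restrict cyl)
  have hwν : MemLp (fun z : ℝ × E3 => w z.1 z.2) 2 ν :=
    hw2.memLp_of_top.mono_measure (prod_restrict_Ioo_mono hS.le)
  have hGν : ∀ j, MemLp (fun z : ℝ × E3 => G j z.1 z.2) 2 ν := fun j =>
    (hG2 j).memLp_of_two.mono_measure (prod_restrict_Ioo_mono hS.le)
  have hvν : MemLp (fun z : ℝ × E3 => v z.1 z.2) 2 ν := h.1.memLp_prod hS 2
  have hpν : ∀ j, MemLp (fun z : ℝ × E3 => pd j (v z.1) z.2) 2 ν := fun j =>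
    (h.1.pd j).memLp_prod hS 2
  have hfν : MemLp (fun z : ℝ × E3 => f z.1 z.2) 2 ν := h.smooth_force.memLp_prod hS 2
  have hDν : MemLp (fun z : ℝ × E3 => dt T v z.1 z.2) 2 ν := h.1.dt.memLp_prod hS 2
  obtain ⟨K, hK0, hK⟩ := h.1.fderivWithin.exists_bound hS
  have hcν : MemLp (fun z : ℝ × E3 => convect (w z.1) (v z.1) z.2) 2 ν := by
    refine MemLp.of_le_mul (c := K) hwν ?_ ?_
    · exact (ContinuousLinearMap.id ℝ (E3 →L[ℝ] E3)).aestronglyMeasurable_comp₂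
        (h.1.fderivWithin.memLp_prod hS 2).1 hwν.1
    · simp only [ν]
      rw [Measure.prod_restrict]
      filter_upwards [ae_restrict_mem (measurableSet_Ioo.prod measurableSet_cyl)] with z hz
      exact ((fderivWithin ℝ (v z.1) cyl z.2).le_opNorm _).trans
        (mul_le_mul_of_nonneg_right (hK z.1 (Ioo_subset_Icc_self hz.1) z.2 hz.2) (norm_nonneg _))
  have i1 := integrable_inner_of_memLp_two hwν hvν
  have i2 := integrable_inner_of_memLp_two hwν hDν
  have i3 := integrable_inner_of_memLp_two hwν hcν
  have i4 : Integrable (fun z : ℝ × E3 => ∑ j, inner ℝ (G j z.1 z.2) (pd j (v z.1) z.2)) ν :=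
    integrable_finsetSum _ fun j _ => integrable_inner_of_memLp_two (hGν j) (hpν j)
  have i5 := integrable_inner_of_memLp_two hfν hvν
  have i6 := integrable_inner_of_memLp_two hfν hwν
  have i7 : Integrable (fun z : ℝ × E3 => ∑ j, ‖G j z.1 z.2‖ ^ 2) ν :=
    integrable_finsetSum _ fun j _ => (memLp_two_iff_integrable_sq_norm (hGν j).1).1 (hGν j)
  have i8 : Integrable (fun z : ℝ × E3 => ∑ j, ‖pd j (v z.1) z.2‖ ^ 2) ν :=
    integrable_finsetSum _ fun j _ => (memLp_two_iff_integrable_sq_norm (hpν j).1).1 (hpν j)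
  have hzν : MemLp (fun z : ℝ × E3 => w z.1 z.2 - v z.1 z.2) 2 ν := hwν.sub hvν
  have i9 := (memLp_two_iff_integrable_sq_norm hzν.1).1 hzν
  have i10 : Integrable (fun z : ℝ × E3 => inner ℝ (w z.1 z.2) (dt T v z.1 z.2)
      + inner ℝ (w z.1 z.2) (convect (w z.1) (v z.1) z.2)
      - ∑ j, inner ℝ (G j z.1 z.2) (pd j (v z.1) z.2) - inner ℝ (f z.1 z.2) (v z.1 z.2)) ν :=
    ((i2.add i3).sub i4).sub i5
  set b : ℝ → ℝ := fun t => ∫ x in cyl, (inner ℝ (w t x) (dt T v t x)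
      + inner ℝ (w t x) (convect (w t) (v t) x)
      - ∑ j, inner ℝ (G j t x) (pd j (v t) x) - inner ℝ (f t x) (v t x))
  set a : ℝ → ℝ := fun t => ∫ x in cyl, inner ℝ (w t x) (v t x)
  have ha : IntegrableOn a (Ioo 0 S) := i1.integral_prod_left
  have hb : IntegrableOn b (Ioo 0 S) := i10.integral_prod_left
  -- The weak formulation with the test fields θ(t)v identifies the weak time derivative of the
  -- pairing of w and v, together with its initial value ‖v(0)‖².
  have habs : ∀ᵐ t ∂(volume.restrict (Ioo 0 S)),
      a t = (∫ x in cyl, ‖v 0 x‖ ^ 2) + ∫ s in Ioo 0 t, b s := by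
    refine ae_eq_add_integral_of_weak_deriv ha hb fun θ hθ ⟨R, hRS, hR⟩ => ?_
    have hRS' : ∀ t, S ≤ t → θ t = 0 := fun t ht => hR t (hRS.le.trans ht)
    have hθ' : ∀ t, S ≤ t → deriv θ t = 0 := fun t ht => by
      have : θ =ᶠ[𝓝 t] fun _ => 0 := by
        filter_upwards [Ioi_mem_nhds (hRS.trans_le ht)] with s hs using hR s (le_of_lt hs)
      rw [this.deriv_eq, deriv_const]
    have hψ := hweak _ (isTestField_smul h hS hθ hRS')
    have hpt : ∀ t ∈ Ico 0 T, ∀ x ∈ cyl,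
        inner ℝ (w t x) (dt T (fun t x => θ t • v t x) t x)
          + inner ℝ (w t x) (convect (w t) (fun x => θ t • v t x) x)
          - ∑ j, inner ℝ (G j t x) (pd j (fun x => θ t • v t x) x)
          - inner ℝ (f t x) (θ t • v t x) =
        deriv θ t * inner ℝ (w t x) (v t x) + θ t * (inner ℝ (w t x) (dt T v t x)
          + inner ℝ (w t x) (convect (w t) (v t) x)
          - ∑ j, inner ℝ (G j t x) (pd j (v t) x) - inner ℝ (f t x) (v t x)) := by
      intro t ht x hx
      have d1 : dt T (fun t x => θ t • v t x) t x = θ t • dt T v t x + deriv θ t • v t x :=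
        ((hθ.differentiable (by simp) t).hasDerivAt.hasDerivWithinAt.smul
          ((h.1.timeSlice hx).differentiableOn (by simp) t ht).hasDerivWithinAt).derivWithin
          (uniqueDiffOn_Ico_zero T t ht)
      have d2 : fderivWithin ℝ (fun x => θ t • v t x) cyl x = θ t • fderivWithin ℝ (v t) cyl x :=
        fderivWithin_fun_const_smul (uniqueDiffOn_cyl x hx)
          ((h.1.slice ht).differentiableOn (by simp) x hx) _
      simp only [convect, pd, d1, d2, _root_.smul_apply, inner_add_right,
        inner_smul_right, ← Finset.mul_sum]
      ring
    rw [setIntegral_eq_of_subset_of_forall_sdiff_eq_zero (s := Ioo 0 S) measurableSet_Ioo hsub]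
      at hψ
    · have e0 : ∫ x in cyl, inner ℝ (v 0 x) (θ 0 • v 0 x) = (∫ x in cyl, ‖v 0 x‖ ^ 2) * θ 0 := by
        rw [← integral_mul_const]
        simp only [inner_smul_right, real_inner_self_eq_norm_sq, mul_comm]
      rw [e0] at hψ
      refine Eq.trans ?_ hψ
      congr 1
      refine integral_congr_ae ?_
      filter_upwards [i1.prod_right_ae, i10.prod_right_ae, ae_restrict_mem measurableSet_Ioo]
        with t h1 h2 ht
      rw [setIntegral_congr_fun measurableSet_cyl (hpt t (hsub' ht)),
        integral_add (h1.const_mul _) (h2.const_mul _), integral_const_mul, integral_const_mul]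
    · intro t ht
      have hSt : S ≤ t := not_lt.1 fun hlt => ht.2 ⟨ht.1.1, hlt⟩
      refine setIntegral_eq_zero_of_forall_eq_zero fun x hx => ?_
      rw [hpt t (Ioo_subset_Ico_self ht.1) x hx, hθ' t hSt, hRS' t hSt]
      ring
  have hrel : ∀ᵐ t ∂(volume.restrict (Ioo 0 S)),
      -(∫ x in cyl, ∑ j, ‖G j t x‖ ^ 2) - (∫ x in cyl, inner ℝ (f t x) (w t x))
      - (∫ x in cyl, ∑ j, ‖pd j (v t) x‖ ^ 2) - (∫ x in cyl, inner ℝ (f t x) (v t x)) - b t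
      ≤ K * ∫ x in cyl, ‖w t x - v t x‖ ^ 2 := by
    filter_upwards [ae_memLp_slice hwν, ae_all_iff.2 fun j => ae_memLp_slice (hGν j),
      ae_restrict_of_ae_restrict_of_subset hsub hbc, ae_restrict_of_ae_restrict_of_subset hsub htr,
      ae_restrict_mem measurableSet_Ioo] with t h1 h2 h3 h4 ht
    exact h.relative_energy (hsub' ht) h1 h2 h3 h4 (hK t (Ioo_subset_Icc_self ht))
  set E : ℝ → ℝ := fun t => ∫ x in cyl, ‖w t x - v t x‖ ^ 2
  have hEi : IntegrableOn E (Ioo 0 S) := i9.integral_prod_left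
  have hE : ∀ᵐ t ∂(volume.restrict (Ioo 0 S)), E t = 0 := by
    -- The energies carry the factor 1/2, so the estimate reads ½E(t) ≤ K∫E.
    refine ae_eq_zero_of_le_integral (C := 2 * K) (by positivity)
      (fun t => integral_nonneg fun x => by positivity) hEi ?_
    filter_upwards [habs, ae_restrict_of_ae_restrict_of_subset hsub hen, ae_memLp_slice hwν,
      i1.prod_right_ae, ae_restrict_mem measurableSet_Ioo] with t hat het hwt hit ht
    have hst : Ioo 0 t ⊆ Ioo 0 S := Ioo_subset_Ioo_right ht.2.le
    have hvt := h.energy_eq (hsub' ht)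
    have hvL := h.1.memLp_slice (hsub' ht)
    have hEt : E t = (∫ x in cyl, ‖w t x‖ ^ 2) - 2 * a t + ∫ x in cyl, ‖v t x‖ ^ 2 := by
      have j1 := (memLp_two_iff_integrable_sq_norm hwt.1).1 hwt
      have j2 := (memLp_two_iff_integrable_sq_norm hvL.1).1 hvL
      simp only [E, a, norm_sub_sq_real]
      have j3 : IntegrableOn (fun x => ‖w t x‖ ^ 2 - 2 * inner ℝ (w t x) (v t x)) cyl :=
        j1.sub (hit.const_mul 2)
      rw [integral_add j3 j2, integral_sub j1 (hit.const_mul 2),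
        integral_const_mul]
    have k1 : IntegrableOn (fun s => ∫ x in cyl, ∑ j, ‖G j s x‖ ^ 2) (Ioo 0 t) :=
      IntegrableOn.mono_set i7.integral_prod_left hst
    have k2 : IntegrableOn (fun s => ∫ x in cyl, inner ℝ (f s x) (w s x)) (Ioo 0 t) :=
      IntegrableOn.mono_set i6.integral_prod_left hst
    have k3 : IntegrableOn (fun s => ∫ x in cyl, ∑ j, ‖pd j (v s) x‖ ^ 2) (Ioo 0 t) :=
      IntegrableOn.mono_set i8.integral_prod_left hst
    have k4 : IntegrableOn (fun s => ∫ x in cyl, inner ℝ (f s x) (v s x)) (Ioo 0 t) :=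
      IntegrableOn.mono_set i5.integral_prod_left hst
    have k5 : IntegrableOn b (Ioo 0 t) := hb.mono_set hst
    have hmono := integral_mono_ae ((((k1.neg.sub k2).sub k3).sub k4).sub k5)
      ((hEi.mono_set hst).const_mul K) (ae_restrict_of_ae_restrict_of_subset hst hrel)
    have hsplit : ∫ s in Ioo 0 t, (-(∫ x in cyl, ∑ j, ‖G j s x‖ ^ 2)
        - (∫ x in cyl, inner ℝ (f s x) (w s x))
        - (∫ x in cyl, ∑ j, ‖pd j (v s) x‖ ^ 2) - (∫ x in cyl, inner ℝ (f s x) (v s x)) - b s) =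
        -(∫ s in Ioo 0 t, ∫ x in cyl, ∑ j, ‖G j s x‖ ^ 2)
        - (∫ s in Ioo 0 t, ∫ x in cyl, inner ℝ (f s x) (w s x))
        - (∫ s in Ioo 0 t, ∫ x in cyl, ∑ j, ‖pd j (v s) x‖ ^ 2)
        - (∫ s in Ioo 0 t, ∫ x in cyl, inner ℝ (f s x) (v s x)) - ∫ s in Ioo 0 t, b s := by
      rw [integral_sub (((k1.fun_neg.fun_sub k2).fun_sub k3).fun_sub k4) k5,
        integral_sub ((k1.fun_neg.fun_sub k2).fun_sub k3) k4,
        integral_sub (k1.fun_neg.fun_sub k2) k3, integral_sub k1.fun_neg k2, integral_neg]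
    have hmono' := hsplit.symm.trans_le hmono
    rw [integral_const_mul] at hmono'
    rw [hEt]
    linarith
  filter_upwards [hE, i9.prod_right_ae] with t ht hi
  have := (integral_eq_zero_iff_of_nonneg (fun x => by positivity) hi).1 ht
  filter_upwards [this] with x hx
  exact sub_eq_zero.1 (norm_eq_zero.1 (pow_eq_zero_iff two_ne_zero |>.1 hx))

/-- Weak-strong uniqueness. -/
theorem IsClassicalSolution.ae_eq_of_isLerayHopf (h : IsClassicalSolution T f v)
    (hw : IsLerayHopf T f (v 0) w) :
    ∀ᵐ t ∂(volume.restrict (Ioo 0 T)), ∀ᵐ x ∂(volume.restrict cyl), w t x = v t x := by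
  obtain ⟨s, -, hs, hlim⟩ := exists_seq_strictMono_tendsto T
  have hU : Ioo 0 T = ⋃ n, Ioo 0 (s n) := by
    ext t
    simp only [mem_iUnion, mem_Ioo]
    constructor
    · rintro ⟨h0, h1⟩
      obtain ⟨n, hn⟩ := (hlim.eventually (lt_mem_nhds h1)).exists
      exact ⟨n, h0, hn⟩
    · rintro ⟨n, h0, h1⟩
      exact ⟨h0, h1.trans (hs n)⟩
  rw [hU, ae_restrict_iUnion_iff]
  exact fun n => h.ae_eq_of_isLerayHopf_of_lt hw (hs n)

theorem SmoothST.memLtLx_of_lt {F : Type*} [NormedAddCommGroup F] [NormedSpace ℝ F] {T S : ℝ}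
    (hS : S < T) {g : ℝ → E3 → F} (hg : SmoothST T g) (q p : ℝ≥0∞) : MemLtLx S q p g := by
  obtain ⟨C, -, hC⟩ := hg.exists_bound hS
  refine ⟨(hg.mono hS.le).aestronglyMeasurable, ?_⟩
  set M : ℝ≥0∞ := (volume.restrict cyl) univ ^ p.toReal⁻¹ * ENNReal.ofReal C
  have hM : M ≠ ⊤ := ENNReal.mul_ne_top
    (ENNReal.rpow_ne_top_of_nonneg (by positivity) (measure_ne_top _ _)) ENNReal.ofReal_ne_top
  have hb : ∀ᵐ t ∂(volume.restrict (Ioo 0 S)), ‖eLpNorm (g t) p (volume.restrict cyl)‖ₑ ≤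
      ‖M.toReal‖ₑ := by
    filter_upwards [ae_restrict_mem measurableSet_Ioo] with t ht
    rw [enorm_eq_self, Real.enorm_of_nonneg ENNReal.toReal_nonneg, ENNReal.ofReal_toReal hM]
    refine eLpNorm_le_of_ae_bound ?_
    filter_upwards [ae_restrict_mem measurableSet_cyl] with x hx
      using hC t (Ioo_subset_Icc_self ht) x hx
  refine (eLpNorm_mono_enorm_ae hb).trans_lt ?_
  exact (memLp_const (M.toReal) : MemLp _ q (volume.restrict (Ioo 0 S))).2

/-- Uniqueness of classical solutions. -/
theorem IsClassicalSolution.unique (h : IsClassicalSolution T f v) (hw : IsClassicalSolution T f w)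
    (h0 : ∀ x ∈ cyl, w 0 x = v 0 x) : ∀ t ∈ Ico 0 T, ∀ x ∈ cyl, w t x = v t x := by
  intro t ht
  -- Nothing is known about w near T. On (0,S) with S < T all norms of w are finite, so it is a
  -- Leray–Hopf solution there.
  obtain ⟨S, htS, hST⟩ := exists_between ht.2
  have hS0 : 0 < S := ht.1.trans_lt htS
  have hLH : IsLerayHopf S f (w 0) w := (hw.mono hST.le).isLerayHopf hS0
    (hw.1.memLtLx_of_lt hST _ _) fun j => (hw.1.pd j).memLtLx_of_lt hST _ _
  have hLH' : IsLerayHopf S f (v 0) w := by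
    obtain ⟨c1, G, c2, c3, c4, c5, c6⟩ := hLH
    refine ⟨c1, G, c2, c3, c4, fun ψ hψ => ?_, ?_⟩
    · refine Eq.trans ?_ (c5 ψ hψ)
      congr 1
      exact setIntegral_congr_fun measurableSet_cyl fun x hx => by simp only [h0 x hx]
    · have : ∫ x in cyl, ‖v 0 x‖ ^ 2 = ∫ x in cyl, ‖w 0 x‖ ^ 2 :=
        setIntegral_congr_fun measurableSet_cyl fun x hx => by simp only [h0 x hx]
      rw [this]; exact c6
  have hae := (h.mono hST.le).ae_eq_of_isLerayHopf hLH'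
  -- Almost everywhere equality is upgraded by continuity, first in x and then in t.
  have hx : ∀ᵐ s ∂(volume.restrict (Ioo 0 S)), ∀ x ∈ cyl, w s x = v s x := by
    filter_upwards [hae, ae_restrict_mem measurableSet_Ioo] with s hs hs'
    have hs'' : s ∈ Ico 0 T := ⟨hs'.1.le, hs'.2.trans hST⟩
    exact Measure.eqOn_of_ae_eq hs (hw.1.slice hs'').continuousOn (h.1.slice hs'').continuousOn
      cyl_subset_closure_interior
  intro x hxc
  have hsub : Ico 0 S ⊆ Ico 0 T := Ico_subset_Ico_right hST.le
  have heq : EqOn (fun s => w s x) (fun s => v s x) (Ico 0 S) := by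
    refine Measure.eqOn_of_ae_eq (μ := volume) ?_
      ((hw.1.timeSlice hxc).continuousOn.mono hsub) ((h.1.timeSlice hxc).continuousOn.mono hsub) ?_
    · rw [Measure.restrict_congr_set Ioo_ae_eq_Ico.symm]
      filter_upwards [hx] with s hs using hs x hxc
    · rw [interior_Ico, closure_Ioo hS0.ne]
      exact Ico_subset_Icc_self
  exact heq ⟨ht.1, htS⟩

end

/-! ### The swirling profile -/

/-- The direction of the axis. -/
def axis : E3 := EuclideanSpace.single 2 1

/-- The square of the distance to the axis. -/
def radSq (y : E3) : ℝ := y 0 ^ 2 + y 1 ^ 2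

/-- The rotation by a right angle in the horizontal plane. -/
def rot : E3 →L[ℝ] E3 :=
  (EuclideanSpace.proj 0 : E3 →L[ℝ] ℝ).smulRight (EuclideanSpace.single 1 1) -
    (EuclideanSpace.proj 1 : E3 →L[ℝ] ℝ).smulRight (EuclideanSpace.single 0 1)

theorem rot_zero (y : E3) : rot y 0 = -y 1 := by simp [rot]
theorem rot_one (y : E3) : rot y 1 = y 0 := by simp [rot]
theorem rot_two (y : E3) : rot y 2 = 0 := by simp [rot]

/-- A bump function of the squared distance to the axis, supported in `(1/4, 3/4)`. -/
def bump : ContDiffBump (1 / 2 : ℝ) := ⟨1 / 8, 1 / 4, by norm_num, by norm_num⟩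

theorem bump_eq_zero {s : ℝ} (h : s ≤ 1 / 4 ∨ 3 / 4 ≤ s) : bump s = 0 := by
  apply bump.zero_of_le_dist
  show (1 / 4 : ℝ) ≤ _
  rw [Real.dist_eq, le_abs]
  rcases h with h | h
  · right; linarith
  · left; linarith

theorem bump_half : bump (1 / 2) = 1 :=
  bump.one_of_mem_closedBall (Metric.mem_closedBall_self (by norm_num [bump]))

theorem contDiff_radSq : ContDiff ℝ ∞ radSq := by
  unfold radSq
  have h : ∀ i : Fin 3, ContDiff ℝ ∞ fun y : E3 => y i := fun i => contDiff_euclidean.1 contDiff_id i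
  exact ((h 0).pow 2).add ((h 1).pow 2)

theorem hasFDerivAt_radSq (y : E3) : HasFDerivAt radSq
    ((2 * y 0) • (EuclideanSpace.proj 0 : E3 →L[ℝ] ℝ) +
      (2 * y 1) • (EuclideanSpace.proj 1 : E3 →L[ℝ] ℝ)) y := by
  have h : ∀ i : Fin 3, HasFDerivAt (fun y : E3 => y i) (EuclideanSpace.proj i : E3 →L[ℝ] ℝ) y :=
    fun i => (EuclideanSpace.proj i : E3 →L[ℝ] ℝ).hasFDerivAt
  unfold radSq
  refine (((h 0).pow 2).add ((h 1).pow 2)).congr_fderiv ?_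
  norm_num

/-- The profile of the velocity. -/
def profile (y : E3) : E3 := bump (radSq y) • rot y

theorem contDiff_profile : ContDiff ℝ ∞ profile :=
  (bump.contDiff.comp contDiff_radSq).smul rot.contDiff

theorem profile_eq_zero {y : E3} (h : radSq y ≤ 1 / 4 ∨ 3 / 4 ≤ radSq y) : profile y = 0 := by
  rw [profile, bump_eq_zero h, zero_smul]

theorem fderiv_profile_apply (y a : E3) : fderiv ℝ profile y a =
    (deriv bump (radSq y) * (2 * y 0 * a 0 + 2 * y 1 * a 1)) • rot y + bump (radSq y) • rot a := by
  have hb : HasDerivAt bump (deriv bump (radSq y)) (radSq y) :=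
    ((bump.contDiff (n := 1)).differentiable one_ne_zero _).hasDerivAt
  have h := (hb.comp_hasFDerivAt y (hasFDerivAt_radSq y)).smul rot.hasFDerivAt
  rw [show fderiv ℝ profile y = _ from h.fderiv]
  simp [add_comm, mul_add]

/-- The profile of the pressure. -/
def pressureProfile (y : E3) : ℝ := (1 / 2) * ∫ s in (0 : ℝ)..radSq y, bump s ^ 2

theorem hasDerivAt_integral_bump_sq (r : ℝ) :
    HasDerivAt (fun r : ℝ => ∫ s in (0 : ℝ)..r, bump s ^ 2) (bump r ^ 2) r := by
  have hc : Continuous fun s => bump s ^ 2 := bump.continuous.pow 2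
  exact intervalIntegral.integral_hasDerivAt_right (hc.intervalIntegrable _ _)
    (hc.stronglyMeasurableAtFilter _ _) hc.continuousAt

theorem contDiff_pressureProfile : ContDiff ℝ ∞ pressureProfile := by
  have h : ContDiff ℝ ∞ fun r : ℝ => ∫ s in (0 : ℝ)..r, bump s ^ 2 := by
    rw [contDiff_infty_iff_deriv, funext fun r => (hasDerivAt_integral_bump_sq r).deriv]
    exact ⟨fun r => (hasDerivAt_integral_bump_sq r).differentiableAt, bump.contDiff.pow 2⟩
  exact contDiff_const.mul (h.comp contDiff_radSq)

/-- The pressure balances the centrifugal force. -/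
theorem fderiv_profile_self_add_pressure (y : E3) (i : Fin 3) :
    fderiv ℝ profile y (profile y) i + fderiv ℝ pressureProfile y (EuclideanSpace.single i 1) = 0 := by
  have hp : HasFDerivAt pressureProfile _ y :=
    ((hasDerivAt_integral_bump_sq (radSq y)).comp_hasFDerivAt y (hasFDerivAt_radSq y)).const_mul
      (1 / 2 : ℝ)
  -- The profile is tangential, so the term with the derivative of `bump` drops out. What is left is
  -- -bump²(y₁, y₂, 0), and the gradient of the pressure is its negative.
  rw [hp.fderiv, fderiv_profile_apply, profile]
  fin_cases i <;> simp [rot_zero, rot_one, rot_two] <;> ring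

/-- The gradient of a radial factor is orthogonal to the rotation field, and the rotation has trace
zero. -/
theorem trace_fderiv_profile (y : E3) :
    ∑ j, fderiv ℝ profile y (EuclideanSpace.single j 1) j = 0 := by
  rw [Fin.sum_univ_three]
  simp only [fderiv_profile_apply, PiLp.add_apply, PiLp.smul_apply, smul_eq_mul, rot_zero, rot_one,
    rot_two]
  simp
  ring

/-! ### Functions of the horizontal variables -/

section invariant
variable {F : Type*} [NormedAddCommGroup F]

/-- Functions of the horizontal coordinates, supported in the unit disc. -/
def IsHorizontal (Φ : E3 → F) : Prop :=
  (∀ y (s : ℝ), Φ (y + s • axis) = Φ y) ∧ tsupport Φ ⊆ {y | radSq y ≤ 1}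

theorem IsHorizontal.eq_zero {Φ : E3 → F} (h : IsHorizontal Φ) {y : E3} (hy : 1 < radSq y) :
    Φ y = 0 :=
  image_eq_zero_of_notMem_tsupport fun h' => absurd (h.2 h') (not_le.2 hy)

/-- The support is not compact, but a translation along the axis moves any point of it into the unit
disc of a fixed plane. -/
theorem IsHorizontal.exists_bound {Φ : E3 → F} (h : IsHorizontal Φ) (hc : Continuous Φ) :
    ∃ C, 0 ≤ C ∧ ∀ y, ‖Φ y‖ ≤ C := by
  obtain ⟨C, hC⟩ := (isCompact_closedBall (0 : E3) 1).exists_bound_of_continuousOn hc.continuousOn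
  refine ⟨max C 0, le_max_right _ _, fun y => ?_⟩
  rcases le_or_gt (radSq y) 1 with hy | hy
  · rw [← h.1 y (-y 2)]
    refine (hC _ ?_).trans (le_max_left _ _)
    rw [mem_closedBall_zero_iff]
    have := norm_sq_E3 (y + (-y 2) • axis)
    simp [axis] at this
    unfold radSq at hy
    simp only [axis, neg_smul]
    nlinarith [norm_nonneg (y + -(y 2 • EuclideanSpace.single (2 : Fin 3) (1 : ℝ)))]
  · rw [h.eq_zero hy, norm_zero]; exact le_max_right _ _

variable [NormedSpace ℝ F]

theorem radSq_add_axis (y : E3) (s : ℝ) : radSq (y + s • axis) = radSq y := by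
  simp [radSq, axis]

theorem isHorizontal_profile : IsHorizontal profile := by
  constructor
  · intro y s
    have : rot (y + s • axis) = rot y := by
      ext i; fin_cases i <;> simp [rot_zero, rot_one, rot_two, axis]
    rw [profile, profile, radSq_add_axis, this]
  · refine closure_minimal (fun y hy => ?_) (isClosed_le contDiff_radSq.continuous continuous_const)
    by_contra h
    exact hy (profile_eq_zero (Or.inr (by
      have : 1 < radSq y := not_le.1 h
      linarith)))

theorem IsHorizontal.fderiv {Φ : E3 → F} (h : IsHorizontal Φ) : IsHorizontal (fderiv ℝ Φ) := by
  refine ⟨fun y s => ?_, (tsupport_fderiv_subset ℝ).trans h.2⟩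
  rw [← fderiv_comp_add_right]
  simp only [h.1]

theorem IsHorizontal.clm_comp {G : Type*} [NormedAddCommGroup G] [NormedSpace ℝ G] {Φ : E3 → F}
    (h : IsHorizontal Φ) (L : F →L[ℝ] G) : IsHorizontal fun y => L (Φ y) :=
  ⟨fun y s => by simp only [h.1], (closure_mono (Function.support_comp_subset L.map_zero Φ)).trans h.2⟩

theorem IsHorizontal.fderiv_axis {Φ : E3 → F} (h : IsHorizontal Φ) (hd : Differentiable ℝ Φ)
    (y : E3) : _root_.fderiv ℝ Φ y axis = 0 := by
  have hl : HasDerivAt (fun s : ℝ => y + s • axis) axis 0 := by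
    simpa using ((hasDerivAt_id (0 : ℝ)).smul_const axis).const_add y
  have h1 : HasFDerivAt Φ (_root_.fderiv ℝ Φ y) (y + (0 : ℝ) • axis) := by
    simpa using (hd y).hasFDerivAt
  have h2 := h1.comp_hasDerivAt (0 : ℝ) hl
  have h3 : HasDerivAt (Φ ∘ fun s : ℝ => y + s • axis) 0 0 := by
    have : (Φ ∘ fun s : ℝ => y + s • axis) = fun _ => Φ y := funext fun s => h.1 y s
    rw [this]; exact hasDerivAt_const _ _
  exact h2.unique h3

/-- This derivative appears when the scale of a self-similar field is differentiated in time. The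
axial part of y does not contribute. -/
theorem IsHorizontal.radial {Φ : E3 → F} (h : IsHorizontal Φ) (hd : Differentiable ℝ Φ) :
    IsHorizontal fun y => _root_.fderiv ℝ Φ y y := by
  refine ⟨fun y s => ?_, ?_⟩
  · simp only [h.fderiv.1]
    rw [map_add, map_smul, h.fderiv_axis hd, smul_zero, add_zero]
  · refine (closure_mono fun y hy => ?_).trans h.fderiv.2
    intro h0
    exact hy (by simp [h0])

end invariant

/-! ### Mixed Lebesgue norms of concentrating fields -/

/-- The normalized time to blow-up. -/
def rem (T t : ℝ) : ℝ := 1 - t / T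

theorem rem_pos {T t : ℝ} (hT : 0 < T) (ht : t < T) : 0 < rem T t := by
  rw [rem, sub_pos, div_lt_one hT]; exact ht

theorem rem_le_one {T t : ℝ} (hT : 0 < T) (ht : 0 ≤ t) : rem T t ≤ 1 := by
  rw [rem]; linarith [div_nonneg ht hT.le]

theorem rem_self {T : ℝ} (hT : 0 < T) : rem T T = 0 := by rw [rem, div_self hT.ne', sub_self]

theorem hasDerivAt_rem (T t : ℝ) : HasDerivAt (rem T) (-T⁻¹) t := by
  unfold rem
  simpa using ((hasDerivAt_id t).div_const T).const_sub 1

theorem continuous_rem (T : ℝ) : Continuous (rem T) := by unfold rem; fun_prop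

/-- The tube lies in a box with sides 2ρ, 2ρ and 1. Only the power ρ² matters. -/
theorem volume_tube_le {ρ : ℝ} (hρ : 0 ≤ ρ) :
    volume (cyl ∩ {x | radSq x ≤ ρ ^ 2}) ≤ ENNReal.ofReal (4 * ρ ^ 2) := by
  have hsub : cyl ∩ {x | radSq x ≤ ρ ^ 2} ⊆
      (WithLp.ofLp : E3 → Fin 3 → ℝ) ⁻¹' Icc (![-ρ, -ρ, 0]) (![ρ, ρ, 1]) := by
    rintro x ⟨hx, hr⟩
    simp only [radSq, mem_ofPred_eq] at hr
    have h0 := abs_le.1 (abs_le_of_sq_le_sq (by nlinarith [sq_nonneg (x 1)] : x 0 ^ 2 ≤ ρ ^ 2) hρ)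
    have h1 := abs_le.1 (abs_le_of_sq_le_sq (by nlinarith [sq_nonneg (x 0)] : x 1 ^ 2 ≤ ρ ^ 2) hρ)
    constructor
    · intro i; fin_cases i
      · exact h0.1
      · exact h1.1
      · exact hx.2.1
    · intro i; fin_cases i
      · exact h0.2
      · exact h1.2
      · exact hx.2.2
  refine (measure_mono hsub).trans ?_
  rw [(PiLp.volume_preserving_ofLp (Fin 3)).measure_preimage measurableSet_Icc.nullMeasurableSet,
    Real.volume_Icc_pi, Fin.prod_univ_three]
  simp only [Matrix.cons_val_zero, Matrix.cons_val_one, Matrix.cons_val]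
  rw [← ENNReal.ofReal_mul (by linarith), ← ENNReal.ofReal_mul (by nlinarith)]
  exact ENNReal.ofReal_le_ofReal (by nlinarith)

/-- An affine change of variables reduces this to the integrability of s^a on (0,1) for a > -1. -/
theorem memLp_rpow_rem {T e : ℝ} (hT : 0 < T) {q : ℝ≥0∞} (h1 : q = ⊤ → 0 ≤ e)
    (h2 : q ≠ ⊤ → -1 < q.toReal * e) :
    MemLp (fun t => rem T t ^ e) q (volume.restrict (Ioo 0 T)) := by
  have hcont : ContinuousOn (fun t => rem T t ^ e) (Ioo 0 T) := by
    refine (continuous_rem T).continuousOn.rpow_const fun t ht => Or.inl (rem_pos hT ht.2).ne'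
  have hm : AEStronglyMeasurable (fun t => rem T t ^ e) (volume.restrict (Ioo 0 T)) :=
    hcont.aestronglyMeasurable measurableSet_Ioo
  by_cases hq : q = ⊤
  · rw [hq]
    refine MemLp.of_bound hm 1 ?_
    filter_upwards [ae_restrict_mem measurableSet_Ioo] with t ht
    have := rem_pos hT ht.2
    rw [Real.norm_of_nonneg (by positivity)]
    exact Real.rpow_le_one this.le (rem_le_one hT ht.1.le) (h1 hq)
  by_cases hq0 : q = 0
  · rw [hq0]; exact memLp_zero_iff_aestronglyMeasurable.2 hm
  rw [← integrable_norm_rpow_iff hm hq0 hq]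
  have hi : IntervalIntegrable (fun t => rem T t ^ (q.toReal * e)) volume 0 T := by
    have h := (intervalIntegral.intervalIntegrable_rpow' (h2 hq) (a := 0) (b := 1))
    have h' := (h.comp_sub_left 1).comp_mul_left (c := T⁻¹)
    rw [intervalIntegrable_iff, uIoc_comm] at h'
    simp only [sub_zero, sub_self, zero_div, one_div, inv_inv] at h'
    rw [← intervalIntegrable_iff] at h'
    convert h' using 2 with t
    rw [rem, div_eq_inv_mul]
  rw [intervalIntegrable_iff_integrableOn_Ioo_of_le hT.le] at hi
  refine hi.congr ?_
  filter_upwards [ae_restrict_mem measurableSet_Ioo] with t ht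
  have := rem_pos hT ht.2
  rw [Real.norm_of_nonneg (by positivity), ← Real.rpow_mul this.le, mul_comm]

/-- With ρ = (1 - t/T)^γ, amplitude ρ^b on a tube of volume at most 4ρ² gives an L^p norm of order
at most ρ^(b+2/p), a power of 1 - t/T whose L^q norm is finite under the two conditions. -/
theorem memLtLx_of_concentrating {F : Type*} [NormedAddCommGroup F] [NormedSpace ℝ F]
    {T γ b C p : ℝ} {q : ℝ≥0∞} (hT : 0 < T) (hp : 0 < p) (hC : 0 ≤ C)
    {g : ℝ → E3 → F} (hg : SmoothST T g)
    (hb : ∀ t ∈ Ioo 0 T, ∀ x ∈ cyl, ‖g t x‖ ≤ C * rem T t ^ (γ * b))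
    (hz : ∀ t ∈ Ioo 0 T, ∀ x ∈ cyl, (rem T t ^ γ) ^ 2 < radSq x → g t x = 0)
    (h1 : q = ⊤ → 0 ≤ γ * (b + 2 / p)) (h2 : q ≠ ⊤ → -1 < q.toReal * (γ * (b + 2 / p))) :
    MemLtLx T q (ENNReal.ofReal p) g := by
  refine ⟨hg.aestronglyMeasurable, ?_⟩
  have hmem := (memLp_rpow_rem hT h1 h2).const_mul (C * 4 ^ (1 / p))
  refine (eLpNorm_mono_enorm_ae ?_).trans_lt hmem.2
  filter_upwards [ae_restrict_mem measurableSet_Ioo] with t ht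
  have hr := rem_pos hT ht.2
  set ρ := rem T t ^ γ
  have hρ : 0 < ρ := Real.rpow_pos_of_pos hr _
  have hc0 : 0 ≤ C * rem T t ^ (γ * b) := by positivity
  have hR : MeasurableSet {x : E3 | radSq x ≤ ρ ^ 2} :=
    (isClosed_le contDiff_radSq.continuous continuous_const).measurableSet
  have hle : eLpNorm (g t) (ENNReal.ofReal p) (volume.restrict cyl) ≤
      eLpNorm ({x : E3 | radSq x ≤ ρ ^ 2}.indicator fun _ => C * rem T t ^ (γ * b))
        (ENNReal.ofReal p) (volume.restrict cyl) := by
    refine eLpNorm_mono_ae ?_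
    filter_upwards [ae_restrict_mem measurableSet_cyl] with x hx
    by_cases h : radSq x ≤ ρ ^ 2
    · rw [indicator_of_mem (show x ∈ {x : E3 | radSq x ≤ ρ ^ 2} from h), Real.norm_of_nonneg hc0]
      exact hb t ht x hx
    · rw [hz t ht x hx (not_le.1 h), norm_zero]; exact norm_nonneg _
  rw [enorm_eq_self]
  refine hle.trans ?_
  rw [eLpNorm_indicator_const hR (by simpa using hp) ENNReal.ofReal_ne_top,
    Measure.restrict_apply hR, inter_comm, ENNReal.toReal_ofReal hp.le, Real.enorm_of_nonneg hc0,
    Real.enorm_of_nonneg (by positivity)]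
  refine (mul_le_mul_right (ENNReal.rpow_le_rpow (volume_tube_le hρ.le) (by positivity)) _).trans ?_
  rw [ENNReal.ofReal_rpow_of_pos (by positivity), ← ENNReal.ofReal_mul hc0]
  refine ENNReal.ofReal_le_ofReal (le_of_eq ?_)
  rw [Real.mul_rpow (by norm_num) (by positivity), ← Real.rpow_natCast, ← Real.rpow_mul hρ.le,
    ← Real.rpow_mul hr.le, mul_add γ, Real.rpow_add hr]
  have : γ * (((2 : ℕ) : ℝ) * (1 / p)) = γ * (2 / p) := by push_cast; ring
  rw [this]; ring

/-! ### The self-similar swirl -/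

section scaled
variable {F : Type*} [NormedAddCommGroup F] [NormedSpace ℝ F]

/-- A profile, concentrated at the scale `(1 - t/T)^γ` and of size `(1 - t/T)^a`. -/
def scaled (T γ a : ℝ) (Φ : E3 → F) (t : ℝ) (x : E3) : F :=
  rem T t ^ a • Φ (rem T t ^ (-γ) • x)

theorem contDiffAt_scaled {T γ a : ℝ} (hT : 0 < T) {Φ : E3 → F} (hΦ : ContDiff ℝ ∞ Φ)
    {z : ℝ × E3} (hz : z.1 < T) :
    ContDiffAt ℝ ∞ (fun z : ℝ × E3 => scaled T γ a Φ z.1 z.2) z := by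
  have hr : ContDiffAt ℝ ∞ (fun z : ℝ × E3 => rem T z.1) z := by unfold rem; fun_prop
  have hp : ∀ e : ℝ, ContDiffAt ℝ ∞ (fun z : ℝ × E3 => rem T z.1 ^ e) z := fun e =>
    hr.rpow_const_of_ne (rem_pos hT hz).ne'
  exact (hp a).smul (hΦ.contDiffAt.comp z ((hp (-γ)).smul contDiffAt_snd))

theorem smoothST_scaled {T γ a : ℝ} (hT : 0 < T) {Φ : E3 → F} (hΦ : ContDiff ℝ ∞ Φ) :
    SmoothST T (scaled T γ a Φ) :=
  fun _ hz => (contDiffAt_scaled hT hΦ hz.1.2).contDiffWithinAt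

/-- A space derivative divides by the length scale, so it costs γ in the exponent. -/
theorem hasFDerivAt_scaled {T γ a t : ℝ} (hT : 0 < T) (ht : t < T) {Φ : E3 → F}
    (hΦ : ContDiff ℝ ∞ Φ) (x : E3) :
    HasFDerivAt (scaled T γ a Φ t) (scaled T γ (a - γ) (fderiv ℝ Φ) t x) x := by
  have hr := rem_pos hT ht
  have h1 : HasFDerivAt (fun x : E3 => rem T t ^ (-γ) • x)
      (rem T t ^ (-γ) • ContinuousLinearMap.id ℝ E3) x :=
    (rem T t ^ (-γ) • ContinuousLinearMap.id ℝ E3).hasFDerivAt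
  have h2 := ((hΦ.differentiable (by simp) (rem T t ^ (-γ) • x)).hasFDerivAt.comp x h1).const_smul
    (rem T t ^ a)
  refine h2.congr_fderiv ?_
  ext y
  simp [scaled, sub_eq_add_neg, Real.rpow_add hr, smul_smul]

theorem fderivWithin_scaled {T γ a t : ℝ} (hT : 0 < T) (ht : t < T) {Φ : E3 → F}
    (hΦ : ContDiff ℝ ∞ Φ) {x : E3} (hx : x ∈ cyl) :
    fderivWithin ℝ (scaled T γ a Φ t) cyl x = scaled T γ (a - γ) (fderiv ℝ Φ) t x :=
  (hasFDerivAt_scaled hT ht hΦ x).hasFDerivWithinAt.fderivWithin (uniqueDiffOn_cyl x hx)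

theorem pd_scaled {T γ a t : ℝ} (hT : 0 < T) (ht : t < T) {Φ : E3 → F}
    (hΦ : ContDiff ℝ ∞ Φ) {x : E3} (hx : x ∈ cyl) (j : Fin 3) :
    pd j (scaled T γ a Φ t) x =
      scaled T γ (a - γ) (fun y => fderiv ℝ Φ y (EuclideanSpace.single j 1)) t x := by
  rw [pd, fderivWithin_scaled hT ht hΦ hx]; rfl

/-- A time derivative costs 1 in the exponent. Differentiating the scale gives the radial
derivative, differentiating the amplitude gives the profile itself. -/
theorem hasDerivAt_scaled {T γ a t : ℝ} (hT : 0 < T) (ht : t < T) {Φ : E3 → F}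
    (hΦ : ContDiff ℝ ∞ Φ) (x : E3) :
    HasDerivAt (fun t => scaled T γ a Φ t x)
      (scaled T γ (a - 1) (fun y => T⁻¹ • (γ • fderiv ℝ Φ y y - a • Φ y)) t x) t := by
  have hr := rem_pos hT ht
  have hp : ∀ e : ℝ, HasDerivAt (fun t => rem T t ^ e) (-T⁻¹ * e * rem T t ^ (e - 1)) t :=
    fun e => (hasDerivAt_rem T t).rpow_const (Or.inl hr.ne')
  have h1 := (hΦ.differentiable (by simp) (rem T t ^ (-γ) • x)).hasFDerivAt.comp_hasDerivAt t
    ((hp (-γ)).smul_const x)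
  have h2 := (hp a).smul h1
  refine h2.congr_deriv ?_
  simp only [scaled, Function.comp_apply, map_smul, sub_eq_add_neg, Real.rpow_add hr]
  module

theorem norm_scaled_le {T γ a t C : ℝ} (hr : 0 ≤ rem T t) {Φ : E3 → F} (hΦ : ∀ y, ‖Φ y‖ ≤ C) (x : E3) :
    ‖scaled T γ a Φ t x‖ ≤ C * rem T t ^ a := by
  rw [scaled, norm_smul, Real.norm_of_nonneg (by positivity), mul_comm]
  exact mul_le_mul_of_nonneg_right (hΦ _) (by positivity)

theorem scaled_eq_zero {T γ a t : ℝ} (hT : 0 < T) (ht : t < T) {Φ : E3 → F} (hΦ : IsHorizontal Φ)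
    {x : E3} (hx : (rem T t ^ γ) ^ 2 < radSq x) : scaled T γ a Φ t x = 0 := by
  have hr := rem_pos hT ht
  have hg : 0 < rem T t ^ γ := by positivity
  rw [scaled, hΦ.eq_zero, smul_zero]
  have : radSq (rem T t ^ (-γ) • x) = ((rem T t ^ γ) ^ 2)⁻¹ * radSq x := by
    simp only [radSq, PiLp.smul_apply, smul_eq_mul, Real.rpow_neg hr.le]; ring
  rw [this, ← inv_mul_cancel₀ (pow_pos hg 2).ne']
  exact mul_lt_mul_of_pos_left hx (by positivity)

theorem memLtLx_scaled {T γ b p : ℝ} {q : ℝ≥0∞} (hT : 0 < T) (hp : 0 < p) {Φ : E3 → F}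
    (hΦ : ContDiff ℝ ∞ Φ) (hh : IsHorizontal Φ)
    (h1 : q = ⊤ → 0 ≤ γ * (b + 2 / p)) (h2 : q ≠ ⊤ → -1 < q.toReal * (γ * (b + 2 / p))) :
    MemLtLx T q (ENNReal.ofReal p) (scaled T γ (γ * b) Φ) := by
  obtain ⟨C, hC, hb⟩ := hh.exists_bound hΦ.continuous
  exact memLtLx_of_concentrating hT hp hC (smoothST_scaled hT hΦ)
    (fun t ht x _ => norm_scaled_le (rem_pos hT ht.2).le hb x)
    (fun t ht x _ hx => scaled_eq_zero hT ht.2 hh hx) h1 h2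

end scaled

/-! ### The velocity, its pressure and its force -/

theorem contDiff_fderiv_apply {F : Type*} [NormedAddCommGroup F] [NormedSpace ℝ F] {Φ : E3 → F}
    (hΦ : ContDiff ℝ ∞ Φ) (a : E3) : ContDiff ℝ ∞ fun y => fderiv ℝ Φ y a :=
  (hΦ.fderiv_right (m := ∞) (by simp)).clm_apply contDiff_const

theorem IsHorizontal.fderiv_apply {F : Type*} [NormedAddCommGroup F] [NormedSpace ℝ F] {Φ : E3 → F}
    (h : IsHorizontal Φ) (a : E3) : IsHorizontal fun y => _root_.fderiv ℝ Φ y a :=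
  h.fderiv.clm_comp (ContinuousLinearMap.apply ℝ F a)

/-- The velocity field. -/
def velocity (T γ β : ℝ) : ℝ → E3 → E3 := scaled T γ (γ * (β - 1)) profile

/-- The pressure of the velocity field, which balances the centrifugal force. -/
def pressure (T γ β : ℝ) : ℝ → E3 → ℝ := scaled T γ (2 * (γ * (β - 1))) pressureProfile

/-- The force: with the pressure above, it is the defect in the heat equation. -/
def force (T γ β : ℝ) (t : ℝ) (x : E3) : E3 :=
  lap (velocity T γ β t) x - dt T (velocity T γ β) t x

section
variable {T γ β : ℝ}

theorem smoothST_velocity (hT : 0 < T) : SmoothST T (velocity T γ β) :=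
  smoothST_scaled hT contDiff_profile

theorem smoothST_force (hT : 0 < T) : SmoothST T (force T γ β) :=
  (smoothST_velocity hT).lap.sub (smoothST_velocity hT).dt

theorem dt_velocity (hT : 0 < T) {t : ℝ} (ht : t ∈ Ico 0 T) (x : E3) :
    dt T (velocity T γ β) t x = scaled T γ (γ * (β - 1) - 1)
      (fun y => T⁻¹ • (γ • fderiv ℝ profile y y - (γ * (β - 1)) • profile y)) t x :=
  (hasDerivAt_scaled hT ht.2 contDiff_profile x).hasDerivWithinAt.derivWithin
    (uniqueDiffOn_Ico_zero T t ht)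

theorem lap_velocity (hT : 0 < T) {t : ℝ} (ht : t ∈ Ico 0 T) {x : E3} (hx : x ∈ cyl) :
    lap (velocity T γ β t) x = ∑ j : Fin 3, scaled T γ (γ * (β - 1) - γ - γ)
      (fun y => fderiv ℝ (fun y => fderiv ℝ profile y (EuclideanSpace.single j 1)) y
        (EuclideanSpace.single j 1)) t x := by
  refine Finset.sum_congr rfl fun j _ => ?_
  have e : EqOn (pd j (velocity T γ β t)) _ cyl :=
    fun y hy => pd_scaled hT ht.2 contDiff_profile hy j
  rw [pd_congr e hx,
    pd_scaled hT ht.2 (contDiff_fderiv_apply contDiff_profile _) hx]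

theorem velocity_two (t : ℝ) (x : E3) : velocity T γ β t x 2 = 0 := by
  simp [velocity, scaled, profile, rot_two]

theorem one_le_rem_rpow_neg (hT : 0 < T) (hγ : 0 ≤ γ) {t : ℝ} (ht : t ∈ Ico 0 T) :
    1 ≤ rem T t ^ (-γ) :=
  Real.one_le_rpow_of_pos_of_le_one_of_nonpos (rem_pos hT ht.2) (rem_le_one hT ht.1)
    (by linarith)

theorem radSq_smul (c : ℝ) (x : E3) : radSq (c • x) = c ^ 2 * radSq x := by
  simp only [radSq, PiLp.smul_apply, smul_eq_mul]; ring

/-- Convection and pressure cancel pointwise, so the momentum equation is the definition of the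
force. The condition γ ≥ 0 keeps the length scale at most 1 and the support away from the vertical
boundary. -/
theorem isClassicalSolution_velocity (hT : 0 < T) (hγ : 0 ≤ γ) :
    IsClassicalSolution T (force T γ β) (velocity T γ β) := by
  refine ⟨smoothST_velocity hT, ⟨pressure T γ β, smoothST_scaled hT contDiff_pressureProfile,
    fun t ht x hx => ?_⟩, fun t ht x hx => ?_, fun t ht x hx => ?_, fun t ht x hx => ?_⟩
  · have hr := rem_pos hT ht.2
    have key : convect (velocity T γ β t) (velocity T γ β t) x +
        gradientWithin (pressure T γ β t) cyl x = 0 := by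
      ext i
      rw [PiLp.add_apply, gradientWithin_coord, pressure, pd_scaled hT ht.2 contDiff_pressureProfile hx,
        convect, velocity, fderivWithin_scaled hT ht.2 contDiff_profile hx]
      have h := fderiv_profile_self_add_pressure (rem T t ^ (-γ) • x) i
      simp only [scaled, _root_.smul_apply, map_smul, PiLp.smul_apply, smul_eq_mul, PiLp.zero_apply]
      -- The pressure has twice the velocity exponent, so its gradient scales like v·∇v.
      have e : rem T t ^ (2 * (γ * (β - 1)) - γ) =
          rem T t ^ (γ * (β - 1) - γ) * rem T t ^ (γ * (β - 1)) := by
        rw [← Real.rpow_add hr]; congr 1; ring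
      rw [e]
      linear_combination (rem T t ^ (γ * (β - 1) - γ) * rem T t ^ (γ * (β - 1))) * h
    rw [force, sub_sub (lap _ x), key, sub_zero]
  · simp only [dvg, velocity, pd_scaled hT ht.2 contDiff_profile hx]
    have h := trace_fderiv_profile (rem T t ^ (-γ) • x)
    simp only [scaled, PiLp.smul_apply, ← Finset.smul_sum, h, smul_zero]
  · have h1 := one_le_rem_rpow_neg hT hγ ht
    rw [velocity, scaled, profile_eq_zero, smul_zero]
    right
    have hx1 : radSq x = 1 := hx.1
    rw [radSq_smul, hx1]
    nlinarith
  · have h0 : pd 2 (velocity T γ β t) x = 0 := by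
      rw [velocity, pd_scaled hT ht.2 contDiff_profile (horBdry_subset_cyl hx)]
      have h := isHorizontal_profile.fderiv_axis (contDiff_profile.differentiable (by simp))
        (rem T t ^ (-γ) • x)
      rw [axis] at h
      rw [scaled, h, smul_zero]
    refine ⟨velocity_two t x, ?_, ?_⟩ <;> rw [h0] <;> rfl

theorem memLtLx_velocity (hT : 0 < T) {p : ℝ} (hp : 0 < p) {q : ℝ≥0∞}
    (h1 : q = ⊤ → 0 ≤ γ * (β - 1 + 2 / p)) (h2 : q ≠ ⊤ → -1 < q.toReal * (γ * (β - 1 + 2 / p))) :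
    MemLtLx T q (ENNReal.ofReal p) (velocity T γ β) :=
  memLtLx_scaled hT hp contDiff_profile isHorizontal_profile h1 h2

/-- The gradient has amplitude of order ρ^(β-2), and 2/p = 1 for p = 2, so its spatial L² norm is of
order at most ρ^(β-1). -/
theorem memLtLx_pd_velocity (hT : 0 < T) (h : -1 < 2 * (γ * (β - 1))) (j : Fin 3) :
    MemLtLx T 2 2 (fun t => pd j (velocity T γ β t)) := by
  have hm := memLtLx_scaled (T := T) (γ := γ) (b := β - 2) (p := 2) (q := 2) hT two_pos
    (contDiff_fderiv_apply contDiff_profile (EuclideanSpace.single j 1))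
    (isHorizontal_profile.fderiv_apply (EuclideanSpace.single j 1)) (by simp) (fun _ => by
      rw [ENNReal.toReal_ofNat]; convert h using 3; ring)
  rw [ENNReal.ofReal_ofNat] at hm
  have he : ∀ t ∈ Ioo 0 T, ∀ x ∈ cyl, scaled T γ (γ * (β - 2))
      (fun y => fderiv ℝ profile y (EuclideanSpace.single j 1)) t x =
      pd j (velocity T γ β t) x := fun t ht x hx => by
    rw [velocity, pd_scaled hT ht.2 contDiff_profile hx]
    congr 1; ring
  refine ⟨((smoothST_velocity hT).pd j).aestronglyMeasurable, ?_⟩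
  refine (eLpNorm_congr_ae ?_).trans_lt hm.2
  filter_upwards [ae_restrict_mem measurableSet_Ioo] with t ht
  refine (eLpNorm_congr_ae ?_).symm
  filter_upwards [ae_restrict_mem measurableSet_cyl] with x hx using he t ht x hx

/-- The Laplacian has exponent γ(β-3), the time derivative γ(β-1) - 1. The condition γ ≥ 1/2 says
that the second is not smaller, so the bound for the Laplacian serves both. -/
theorem memLtLx_force (hT : 0 < T) (hγ : 1 / 2 ≤ γ) {p : ℝ} (hp : 0 < p) {q : ℝ≥0∞}
    (h1 : q = ⊤ → 0 ≤ γ * (β - 3 + 2 / p)) (h2 : q ≠ ⊤ → -1 < q.toReal * (γ * (β - 3 + 2 / p))) :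
    MemLtLx T q (ENNReal.ofReal p) (force T γ β) := by
  have hd := contDiff_profile.differentiable (by simp : (∞ : WithTop ℕ∞) ≠ 0)
  have hΨh : IsHorizontal fun y =>
      T⁻¹ • (γ • fderiv ℝ profile y y - (γ * (β - 1)) • profile y) := by
    have hr := isHorizontal_profile.radial hd
    refine ⟨fun y s => ?_, ?_⟩
    · have := hr.1 y s
      simp only at this
      simp only [this, isHorizontal_profile.1]
    · refine closure_minimal (fun y hy => ?_) (isClosed_le contDiff_radSq.continuous continuous_const)
      by_contra h
      refine hy ?_
      have h' : 1 < radSq y := not_le.1 h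
      have h3 : fderiv ℝ profile y y = 0 := hr.eq_zero h'
      simp only [h3, isHorizontal_profile.eq_zero h', smul_zero, sub_zero]
  have hΨc : Continuous fun y =>
      T⁻¹ • (γ • fderiv ℝ profile y y - (γ * (β - 1)) • profile y) := by
    have h1 : Continuous fun y => fderiv ℝ profile y y :=
      (contDiff_profile.continuous_fderiv (by simp)).clm_apply continuous_id
    have h2 := contDiff_profile.continuous
    fun_prop
  obtain ⟨C₁, hC₁, hb₁⟩ := hΨh.exists_bound hΨc
  have hLh := fun j : Fin 3 => (isHorizontal_profile.fderiv_apply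
    (EuclideanSpace.single j (1 : ℝ))).fderiv_apply (EuclideanSpace.single j (1 : ℝ))
  have hLc := fun j : Fin 3 => contDiff_fderiv_apply (contDiff_fderiv_apply contDiff_profile
    (EuclideanSpace.single j (1 : ℝ))) (EuclideanSpace.single j (1 : ℝ))
  choose C₂ hC₂ hb₂ using fun j => (hLh j).exists_bound (hLc j).continuous
  refine memLtLx_of_concentrating (C := (∑ j, C₂ j) + C₁) hT hp
    (add_nonneg (Finset.sum_nonneg fun j _ => hC₂ j) hC₁) (smoothST_force hT)
    (fun t ht x hx => ?_) (fun t ht x hx hr => ?_) h1 h2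
  · have hr := rem_pos hT ht.2
    have ht' := Ioo_subset_Ico_self ht
    rw [force, lap_velocity hT ht' hx, dt_velocity hT ht']
    refine (norm_sub_le _ _).trans ?_
    rw [add_mul, Finset.sum_mul]
    refine add_le_add ((norm_sum_le _ _).trans (Finset.sum_le_sum fun j _ => ?_)) ?_
    · refine (norm_scaled_le hr.le (hb₂ j) x).trans (le_of_eq ?_)
      congr 2; ring
    · refine (norm_scaled_le hr.le hb₁ x).trans (mul_le_mul_of_nonneg_left ?_ hC₁)
      exact Real.rpow_le_rpow_of_exponent_ge hr (rem_le_one hT ht.1.le) (by linarith)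
  · have ht' := Ioo_subset_Ico_self ht
    rw [force, lap_velocity hT ht' hx, dt_velocity hT ht', scaled_eq_zero hT ht.2 hΨh hr,
      Finset.sum_eq_zero fun j _ => scaled_eq_zero hT ht.2 (hLh j) hr, sub_zero]

theorem IsWeakGradBC.isWeakGrad {u : E3 → E3} {G : Fin 3 → E3 → E3} (h : IsWeakGradBC u G) :
    IsWeakGrad u G := by
  intro i j ψ hψ _ hs
  have h1 := h i j ψ hψ.contDiffOn fun _ _ x hx => image_eq_zero_of_notMem_tsupport fun h' =>
    not_mem_horBdry_of_interior (hs h') hx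
  rw [← h1]
  refine setIntegral_congr_fun measurableSet_cyl fun x hx => ?_
  simp only [pd]
  rw [fderivWithin_eq_fderiv (uniqueDiffOn_cyl x hx) (hψ.differentiable (by simp) x)]

/-- Any α is admissible: φ contains the compensating factor r^(1-α), harmless because the bump
vanishes near the axis. Since φ(1,t) = 0, the linear correction is absent. -/
theorem isSwirl_velocity (hT : 0 < T) (hγ : 0 ≤ γ) {α : ℝ} : IsSwirl T α (velocity T γ β) := by
  have hz : ∀ r t : ℝ, (rem T t ^ (-γ)) ^ 2 * r ^ 2 < 1 / 4 →
      bump ((rem T t ^ (-γ)) ^ 2 * r ^ 2) = 0 := fun r t h => bump_eq_zero (Or.inl h.le)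
  refine ⟨fun r t => r ^ (1 - α) * (rem T t ^ (γ * (β - 1)) * rem T t ^ (-γ) *
    bump ((rem T t ^ (-γ)) ^ 2 * r ^ 2)), ?_, ?_, ?_⟩
  · rintro ⟨r, t⟩ ⟨hr, ht⟩
    have hpos := rem_pos hT ht.2
    have hrem : ContDiffAt ℝ ∞ (fun z : ℝ × ℝ => rem T z.2) (r, t) := by unfold rem; fun_prop
    have hp : ∀ e : ℝ, ContDiffAt ℝ ∞ (fun z : ℝ × ℝ => rem T z.2 ^ e) (r, t) := fun e =>
      hrem.rpow_const_of_ne hpos.ne'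
    have harg : ContDiffAt ℝ ∞ (fun z : ℝ × ℝ => (rem T z.2 ^ (-γ)) ^ 2 * z.1 ^ 2) (r, t) :=
      ((hp _).pow 2).mul (contDiffAt_fst.pow 2)
    apply ContDiffAt.contDiffWithinAt
    rcases eq_or_ne r 0 with rfl | h0
    · have hev : ∀ᶠ z : ℝ × ℝ in 𝓝 (0, t), (rem T z.2 ^ (-γ)) ^ 2 * z.1 ^ 2 < 1 / 4 :=
        harg.continuousAt.eventually_lt continuousAt_const (by simp)
      refine contDiffAt_const (c := (0 : ℝ)) |>.congr_of_eventuallyEq ?_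
      filter_upwards [hev] with z hz'
      rw [hz _ _ hz']; simp
    · exact (contDiffAt_fst.rpow_const_of_ne h0).mul
        (((hp _).mul (hp _)).mul (bump.contDiff.contDiffAt.comp _ harg))
  · intro t _
    simp only [hz 0 t (by simp), mul_zero]
  · intro t ht x hx
    have hpos := rem_pos hT ht.2
    have h1 : bump ((rem T t ^ (-γ)) ^ 2 * 1 ^ 2) = 0 := by
      have := one_le_rem_rpow_neg hT hγ ht
      exact bump_eq_zero (Or.inr (by nlinarith))
    simp only [h1, mul_zero, zero_mul, sub_zero]
    have hrad2 : rad x ^ 2 = radSq x := Real.sq_sqrt (by positivity)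
    rw [velocity, scaled, profile, radSq_smul, ← hrad2, map_smul]
    rcases eq_or_ne (rad x) 0 with h0 | h0
    · rw [hz _ _ (by simp [h0])]; simp
    · have hr0 : 0 < rad x := lt_of_le_of_ne (Real.sqrt_nonneg _) h0.symm
      have hα : rad x ^ α * rad x ^ (1 - α) = rad x := by
        rw [← Real.rpow_add hr0]; simp
      have hrot : rot x = rad x • eTheta x := by
        ext i
        fin_cases i <;> simp [eTheta, rot_zero, rot_one, rot_two] <;> field_simp
      rw [hrot, smul_smul, smul_smul, smul_smul, ← mul_assoc, hα]
      congr 1; ring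

end

/-! ### Blow-up of the derivatives -/

/-- Taylor's estimate at a point where all derivatives vanish, by repeated use of the mean value
inequality from order n downwards. It turns a lower bound for f into one for its n-th derivative. -/
theorem norm_le_mul_norm_sub_pow {E F : Type*} [NormedAddCommGroup E] [NormedSpace ℝ E]
    [NormedAddCommGroup F] [NormedSpace ℝ F] {s : Set E} (hs : Convex ℝ s)
    (hu : UniqueDiffOn ℝ s) {f : E → F} (hf : ContDiffOn ℝ ∞ f s) {x₀ : E} (hx₀ : x₀ ∈ s)
    (h0 : f =ᶠ[𝓝[s] x₀] fun _ => 0) {n : ℕ} {M : ℝ}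
    (hM : ∀ x ∈ s, ‖iteratedFDerivWithin ℝ n f s x‖ ≤ M) :
    ∀ x ∈ s, ‖f x‖ ≤ M * ‖x - x₀‖ ^ n := by
  have hM0 : 0 ≤ M := (norm_nonneg _).trans (hM x₀ hx₀)
  have key : ∀ j i : ℕ, i + j = n → ∀ x ∈ s,
      ‖iteratedFDerivWithin ℝ i f s x‖ ≤ M * ‖x - x₀‖ ^ j := by
    intro j
    induction j with
    | zero => intro i hi x hx; obtain rfl : i = n := hi; simpa using hM x hx
    | succ j ih =>
      intro i hi x hx
      have hd : DifferentiableOn ℝ (iteratedFDerivWithin ℝ i f s) s :=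
        hf.differentiableOn_iteratedFDerivWithin (by exact_mod_cast WithTop.coe_lt_top i) hu
      have hseg : segment ℝ x₀ x ⊆ s := hs.segment_subset hx₀ hx
      have hz : iteratedFDerivWithin ℝ i f s x₀ = 0 := by
        rw [h0.iteratedFDerivWithin_eq (h0.self_of_nhdsWithin hx₀) i]
        simp
      have := Convex.norm_image_sub_le_of_norm_hasFDerivWithin_le (𝕜 := ℝ)
        (f := iteratedFDerivWithin ℝ i f s) (f' := fderivWithin ℝ (iteratedFDerivWithin ℝ i f s) s)
        (s := segment ℝ x₀ x) (C := M * ‖x - x₀‖ ^ j)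
        (fun y hy => ((hd y (hseg hy)).hasFDerivWithinAt).mono hseg) (fun y hy => ?_)
        (convex_segment x₀ x) (left_mem_segment ℝ x₀ x) (right_mem_segment ℝ x₀ x)
      · rw [hz, sub_zero] at this
        rwa [pow_succ, ← mul_assoc]
      · rw [norm_fderivWithin_iteratedFDerivWithin]
        refine (ih (i + 1) (by omega) y (hseg hy)).trans ?_
        obtain ⟨θ, ⟨hθ0, hθ1⟩, rfl⟩ := (segment_eq_image' ℝ x₀ x ▸ hy :)
        rw [add_sub_cancel_left, norm_smul, Real.norm_of_nonneg hθ0]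
        gcongr
        exact mul_le_of_le_one_left (norm_nonneg _) hθ1
  intro x hx
  have := key n 0 (zero_add n) x hx
  rwa [norm_iteratedFDerivWithin_zero] at this

/-- By continuity the essential supremum bounds every value, including those on the boundary, since
`cyl` lies in the closure of its interior. -/
theorem ContinuousOn.norm_le_of_eLpNorm_top {F : Type*} [NormedAddCommGroup F] {g : E3 → F}
    (hg : ContinuousOn g cyl) (hfin : eLpNorm g ⊤ (volume.restrict cyl) ≠ ⊤) {x : E3}
    (hx : x ∈ cyl) : ‖g x‖ ≤ (eLpNorm g ⊤ (volume.restrict cyl)).toReal := by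
  set M := (eLpNorm g ⊤ (volume.restrict cyl)).toReal
  have hae : (fun y => max ‖g y‖ M) =ᵐ[volume.restrict cyl] fun _ => M := by
    filter_upwards [enorm_ae_le_eLpNormEssSup g (volume.restrict cyl)] with y hy
    refine max_eq_right ?_
    rw [← eLpNorm_exponent_top] at hy
    rw [← toReal_enorm]
    exact ENNReal.toReal_mono hfin hy
  have := Measure.eqOn_of_ae_eq hae (ContinuousOn.sup hg.norm continuousOn_const) continuousOn_const
    cyl_subset_closure_interior hx
  exact max_eq_right_iff.1 this

section
variable {T γ β : ℝ}

theorem velocity_eventuallyEq_zero (t : ℝ) :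
    velocity T γ β t =ᶠ[𝓝[cyl] 0] fun _ => 0 := by
  refine mem_nhdsWithin_of_mem_nhds ?_
  have hc : Continuous fun x : E3 => radSq (rem T t ^ (-γ) • x) :=
    contDiff_radSq.continuous.comp (continuous_const_smul _)
  have : ∀ᶠ x : E3 in 𝓝 0, radSq (rem T t ^ (-γ) • x) < 1 / 4 :=
    hc.continuousAt.eventually_lt continuousAt_const (by simp [radSq])
  filter_upwards [this] with x hx
  rw [velocity, scaled, profile_eq_zero (Or.inl hx.le), smul_zero]

/-- The field vanishes near the origin but has size √(1/2)·ρ^(β-1) at distance √(1/2)·ρ from it, so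
its n-th derivative must reach order ρ^(β-1-n) somewhere. -/
theorem le_eLpNorm_iteratedFDerivWithin_velocity (hT : 0 < T) (hγ : 0 ≤ γ) (n : ℕ) {t : ℝ}
    (ht : t ∈ Ico 0 T) :
    ENNReal.ofReal (√(1 / 2) * rem T t ^ (γ * (β - 1 - n))) ≤
      eLpNorm (iteratedFDerivWithin ℝ n (velocity T γ β t) cyl) ⊤ (volume.restrict cyl) := by
  by_cases hfin : eLpNorm (iteratedFDerivWithin ℝ n (velocity T γ β t) cyl) ⊤
    (volume.restrict cyl) = ⊤
  · rw [hfin]; exact le_top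
  have hr := rem_pos hT ht.2
  have hsm := (smoothST_velocity (γ := γ) (β := β) hT).slice ht
  have hcont : ContinuousOn (iteratedFDerivWithin ℝ n (velocity T γ β t) cyl) cyl :=
    hsm.continuousOn_iteratedFDerivWithin (by exact_mod_cast le_top) uniqueDiffOn_cyl
  have hb := norm_le_mul_norm_sub_pow convex_cyl uniqueDiffOn_cyl hsm
    (x₀ := 0) (by simp [cyl]) (velocity_eventuallyEq_zero t)
    fun x hx => ContinuousOn.norm_le_of_eLpNorm_top hcont hfin hx
  set M := (eLpNorm (iteratedFDerivWithin ℝ n (velocity T γ β t) cyl) ⊤ (volume.restrict cyl)).toReal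
  set ρ := rem T t ^ γ
  have hρ : 0 < ρ := Real.rpow_pos_of_pos hr _
  have hρ1 : ρ ≤ 1 := Real.rpow_le_one hr.le (rem_le_one hT ht.1) hγ
  have hs0 : 0 < √(1 / 2 : ℝ) := Real.sqrt_pos.2 (by norm_num)
  have hs2 : √(1 / 2 : ℝ) ^ 2 = 1 / 2 := Real.sq_sqrt (by norm_num)
  have hs1 : √(1 / 2 : ℝ) ≤ 1 := by nlinarith
  -- After rescaling, the squared radius of this point is 1/2, the centre of the bump.
  set x : E3 := EuclideanSpace.single 0 (ρ * √(1 / 2))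
  have hxc : x ∈ cyl := by
    have h1 : (ρ * √(1 / 2)) ^ 2 ≤ 1 := by rw [mul_pow, hs2]; nlinarith
    have h2 : ∀ c : ℝ, c ^ 2 ≤ 1 → (EuclideanSpace.single 0 c : E3) ∈ cyl := fun c hc => by
      have : |c| ≤ 1 := (sq_le_one_iff_abs_le_one c).1 hc
      simpa [cyl] using this
    exact h2 _ h1
  have hnx : ‖x‖ = ρ * √(1 / 2) := by
    simp only [x, PiLp.norm_single, Real.norm_of_nonneg (by positivity : 0 ≤ ρ * √(1 / 2))]
  have hlx : rem T t ^ (-γ) • x = EuclideanSpace.single 0 (√(1 / 2)) := by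
    have h1 : rem T t ^ (-γ) • x = EuclideanSpace.single 0 (rem T t ^ (-γ) * (ρ * √(1 / 2))) := by
      ext i; fin_cases i <;> simp [x]
    rw [h1, ← mul_assoc, Real.rpow_neg hr.le, inv_mul_cancel₀ hρ.ne', one_mul]
  have hrs : radSq (EuclideanSpace.single 0 (√(1 / 2)) : E3) = 1 / 2 := by
    simp [radSq]
  have hrot : rot (EuclideanSpace.single 0 (√(1 / 2)) : E3) = EuclideanSpace.single 1 (√(1 / 2)) := by
    ext i; fin_cases i <;> simp [rot_zero, rot_one, rot_two]
  have hv : ‖velocity T γ β t x‖ = rem T t ^ (γ * (β - 1)) * √(1 / 2) := by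
    rw [velocity, scaled, hlx, profile, hrs, bump_half, one_smul, hrot, norm_smul,
      PiLp.norm_single, Real.norm_of_nonneg (by positivity), Real.norm_of_nonneg hs0.le]
  have h := hb x hxc
  rw [hv, sub_zero, hnx] at h
  have hM : 0 ≤ M := ENNReal.toReal_nonneg
  have h' : rem T t ^ (γ * (β - 1)) * √(1 / 2) ≤ M * ρ ^ n := h.trans
    (mul_le_mul_of_nonneg_left (pow_le_pow_left₀ (by positivity) (mul_le_of_le_one_right hρ.le hs1) n) hM)
  refine ENNReal.ofReal_le_of_le_toReal ?_
  have e : rem T t ^ (γ * (β - 1 - n)) = rem T t ^ (γ * (β - 1)) / ρ ^ n := by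
    rw [← Real.rpow_natCast, ← Real.rpow_mul hr.le, ← Real.rpow_sub hr]; congr 1; ring
  rw [e, ← mul_div_assoc, div_le_iff₀ (by positivity), mul_comm]
  exact h'

theorem tendsto_eLpNorm_iteratedFDerivWithin_velocity (hT : 0 < T) (hγ : 0 < γ) {n : ℕ}
    (hn : β - 1 < n) :
    Tendsto (fun t => eLpNorm (iteratedFDerivWithin ℝ n (velocity T γ β t) cyl) ⊤
      (volume.restrict cyl)) (𝓝[<] T) (𝓝 ⊤) := by
  have hrem : Tendsto (rem T) (𝓝[<] T) (𝓝[>] 0) := by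
    refine tendsto_nhdsWithin_iff.2 ⟨?_, ?_⟩
    · rw [← rem_self hT]
      exact (continuous_rem T).continuousAt.mono_left nhdsWithin_le_nhds
    · filter_upwards [self_mem_nhdsWithin] with t ht using rem_pos hT ht
  have hpow : Tendsto (fun t => √(1 / 2) * rem T t ^ (γ * (β - 1 - n))) (𝓝[<] T) atTop := by
    refine Tendsto.const_mul_atTop (Real.sqrt_pos.2 (by norm_num)) ?_
    exact (tendsto_rpow_neg_nhdsGT_zero (by nlinarith)).comp hrem
  refine tendsto_nhds_top_mono (ENNReal.tendsto_ofReal_atTop.comp hpow) ?_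
  filter_upwards [Ioo_mem_nhdsLT hT] with t ht
  exact le_eLpNorm_iteratedFDerivWithin_velocity hT hγ.le n (Ioo_subset_Ico_self ht)

end

/-! ### Regularity up to the blow-up time -/

section extension
variable {F : Type*} [NormedAddCommGroup F]

/-- The positive part of `rem` gives a continuous majorant that vanishes from T on. There are two
exponents because time and space derivatives decay at different rates. -/
theorem continuous_of_norm_le_rem_rpow {T C e e' : ℝ} (hT : 0 < T) (he : 0 < e) (he' : 0 < e')
    {g : ℝ × E3 → F} (hc : ∀ z : ℝ × E3, z.1 < T → ContinuousAt g z)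
    (hz : ∀ z : ℝ × E3, T ≤ z.1 → g z = 0)
    (hb : ∀ z : ℝ × E3, z.1 < T → ‖g z‖ ≤ C * (rem T z.1 ^ e + rem T z.1 ^ e')) : Continuous g := by
  refine continuous_iff_continuousAt.2 fun z => ?_
  rcases lt_or_ge z.1 T with h | h
  · exact hc z h
  rw [ContinuousAt, hz z h]
  have hbd : ∀ y : ℝ × E3, ‖g y‖ ≤ |C| * ((max (rem T y.1) 0) ^ e + (max (rem T y.1) 0) ^ e') := fun y => by
    rcases lt_or_ge y.1 T with h | h
    · have hr := rem_pos hT h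
      rw [max_eq_left hr.le]
      exact (hb y h).trans (mul_le_mul_of_nonneg_right (le_abs_self C) (by positivity))
    · rw [hz y h, norm_zero]; positivity
  refine squeeze_zero_norm hbd ?_
  have hz' : max (rem T z.1) 0 = 0 := by
    refine max_eq_right ?_
    rw [rem, sub_nonpos, one_le_div hT]; exact h
  have hcont : Continuous fun y : ℝ × E3 => |C| * ((max (rem T y.1) 0) ^ e + (max (rem T y.1) 0) ^ e') :=
    have hm := ((continuous_rem T).comp (continuous_fst (X := ℝ) (Y := E3))).max
      (continuous_const (y := (0 : ℝ)))
    continuous_const.mul ((hm.rpow_const fun _ => Or.inr he.le).add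
      (hm.rpow_const fun _ => Or.inr he'.le))
  have := hcont.tendsto z
  rwa [hz', Real.zero_rpow he.ne', Real.zero_rpow he'.ne', add_zero, mul_zero] at this

/-- One factor of `rem` is bounded by ‖y - z‖/T; the remaining power e - 1 > 0 makes the quotient
small. -/
theorem hasFDerivAt_zero_of_norm_le_rem_rpow [NormedSpace ℝ F] {T C e : ℝ} (hT : 0 < T) (he : 1 < e)
    {g : ℝ × E3 → F} (hz : ∀ z : ℝ × E3, T ≤ z.1 → g z = 0)
    (hb : ∀ z : ℝ × E3, z.1 < T → ‖g z‖ ≤ C * rem T z.1 ^ e) {z : ℝ × E3} (h : T ≤ z.1) :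
    HasFDerivAt g (0 : ℝ × E3 →L[ℝ] F) z := by
  rw [hasFDerivAt_iff_isLittleO]
  simp only [hz z h, sub_zero, zero_apply]
  have hbd : ∀ y : ℝ × E3, ‖g y‖ ≤ |C| * (max (rem T y.1) 0) ^ (e - 1) * T⁻¹ * ‖y - z‖ := fun y => by
    rcases lt_or_ge y.1 T with hy | hy
    · have hr := rem_pos hT hy
      rw [max_eq_left hr.le]
      have h1 : rem T y.1 ≤ T⁻¹ * ‖y - z‖ := by
        have h2 : rem T y.1 = T⁻¹ * (T - y.1) := by rw [rem]; field_simp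
        rw [h2]
        refine mul_le_mul_of_nonneg_left ?_ (by positivity)
        have h3 : |y.1 - z.1| ≤ ‖y - z‖ := norm_fst_le (y - z)
        have h4 := neg_abs_le (y.1 - z.1)
        linarith
      have h2 : rem T y.1 ^ e = rem T y.1 ^ (e - 1) * rem T y.1 := by
        rw [← Real.rpow_add_one hr.ne']; simp
      refine (hb y hy).trans ?_
      rw [h2, mul_assoc (_ * _)]
      refine (mul_le_mul_of_nonneg_right (le_abs_self C) (by positivity)).trans ?_
      rw [← mul_assoc]
      exact mul_le_mul_of_nonneg_left h1 (by positivity)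
    · rw [hz y hy, norm_zero]; positivity
  refine Asymptotics.isLittleO_iff.2 fun c hc => ?_
  have hz' : max (rem T z.1) 0 = 0 := by
    refine max_eq_right ?_
    rw [rem, sub_nonpos, one_le_div hT]; exact h
  have hcont : Continuous fun y : ℝ × E3 => |C| * (max (rem T y.1) 0) ^ (e - 1) * T⁻¹ :=
    (continuous_const.mul ((((continuous_rem T).comp continuous_fst).max
      continuous_const).rpow_const fun _ => Or.inr (by linarith))).mul continuous_const
  have hev : ∀ᶠ y in 𝓝 z, |C| * (max (rem T y.1) 0) ^ (e - 1) * T⁻¹ < c :=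
    hcont.continuousAt.eventually_lt continuousAt_const (by
      rw [hz', Real.zero_rpow (by linarith)]; simpa using hc)
  filter_upwards [hev] with y hy
  exact (hbd y).trans (mul_le_mul_of_nonneg_right hy.le (norm_nonneg _))

end extension

/-! ### The velocity extended by zero -/

section
variable {T γ β : ℝ}

theorem norm_velocity_le : ∃ C, 0 ≤ C ∧ ∀ {T γ β : ℝ}, 0 < T → ∀ t < T, ∀ x,
    ‖velocity T γ β t x‖ ≤ C * rem T t ^ (γ * (β - 1)) := by
  obtain ⟨C, hC, hb⟩ := isHorizontal_profile.exists_bound contDiff_profile.continuous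
  exact ⟨C, hC, fun hT t ht x => norm_scaled_le (rem_pos hT ht).le hb x⟩

/-- At t = T the amplitude is a nonzero power of 0, hence 0, whatever the argument of the profile.
The defining formula thus already agrees with the extension by zero. -/
theorem velocity_final (hT : 0 < T) (he : γ * (β - 1) ≠ 0) (x : E3) : velocity T γ β T x = 0 := by
  rw [velocity, scaled, rem_self hT, Real.zero_rpow he, zero_smul]

/-- The extension of the velocity by zero past the blow-up time. -/
def velocityExt (T γ β : ℝ) (z : ℝ × E3) : E3 := if z.1 < T then velocity T γ β z.1 z.2 else 0

theorem velocityExt_eq (hT : 0 < T) (he : γ * (β - 1) ≠ 0) :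
    EqOn (fun z : ℝ × E3 => velocity T γ β z.1 z.2) (velocityExt T γ β) (Icc 0 T ×ˢ cyl) := by
  rintro ⟨t, x⟩ ⟨ht, -⟩
  simp only [velocityExt]
  split_ifs with h
  · rfl
  · obtain rfl : t = T := le_antisymm ht.2 (not_lt.1 h)
    exact velocity_final hT he x

theorem velocityExt_eventuallyEq {z : ℝ × E3} (hz : z.1 < T) :
    velocityExt T γ β =ᶠ[𝓝 z] fun z => velocity T γ β z.1 z.2 := by
  filter_upwards [continuous_fst.continuousAt.eventually_lt (continuousAt_const (y := T)) hz] with y hy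
  exact if_pos hy

theorem contDiffAt_velocityExt (hT : 0 < T) {z : ℝ × E3} (hz : z.1 < T) :
    ContDiffAt ℝ ∞ (velocityExt T γ β) z :=
  (contDiffAt_scaled hT contDiff_profile hz).congr_of_eventuallyEq (velocityExt_eventuallyEq hz)

theorem continuous_velocityExt (hT : 0 < T) (he : 0 < γ * (β - 1)) :
    Continuous (velocityExt T γ β) := by
  obtain ⟨C, hC, hb⟩ := norm_velocity_le
  refine continuous_of_norm_le_rem_rpow (C := C) hT he he
    (fun z hz => (contDiffAt_velocityExt hT hz).continuousAt) (fun z hz => if_neg (not_lt.2 hz))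
    fun z hz => ?_
  rw [velocityExt, if_pos hz]
  have := rem_pos hT hz
  have h0 : 0 ≤ C * rem T z.1 ^ (γ * (β - 1)) := by positivity
  linarith [hb (γ := γ) (β := β) hT _ hz z.2]

/-- The space-time derivative is split into its action on time and on space directions, with
exponents lowered by 1 and by γ. -/
theorem norm_fderiv_velocityExt_le (hT : 0 < T) : ∃ C, ∀ z : ℝ × E3, z.1 < T →
    ‖fderiv ℝ (velocityExt T γ β) z‖ ≤
      C * (rem T z.1 ^ (γ * (β - 1) - 1) + rem T z.1 ^ (γ * (β - 1) - γ)) := by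
  have hd := contDiff_profile.differentiable (by simp : (∞ : WithTop ℕ∞) ≠ 0)
  obtain ⟨C₀, hC₀, hb₀⟩ := isHorizontal_profile.exists_bound contDiff_profile.continuous
  obtain ⟨C₁, hC₁, hb₁⟩ := isHorizontal_profile.fderiv.exists_bound
    (contDiff_profile.continuous_fderiv (by simp))
  obtain ⟨C₂, hC₂, hb₂⟩ := (isHorizontal_profile.radial hd).exists_bound
    ((contDiff_profile.continuous_fderiv (by simp)).clm_apply continuous_id)
  set C₃ := T⁻¹ * (|γ| * C₂ + |γ * (β - 1)| * C₀)
  have hb₃ : ∀ y, ‖T⁻¹ • (γ • fderiv ℝ profile y y - (γ * (β - 1)) • profile y)‖ ≤ C₃ := fun y => by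
    rw [norm_smul, Real.norm_of_nonneg (by positivity)]
    refine mul_le_mul_of_nonneg_left ((norm_sub_le _ _).trans (add_le_add ?_ ?_)) (by positivity)
    · rw [norm_smul, Real.norm_eq_abs]; exact mul_le_mul_of_nonneg_left (hb₂ y) (abs_nonneg _)
    · rw [norm_smul, Real.norm_eq_abs]; exact mul_le_mul_of_nonneg_left (hb₀ y) (abs_nonneg _)
  have hC₃ : 0 ≤ C₃ := (norm_nonneg _).trans (hb₃ 0)
  refine ⟨C₃ + C₁, fun z hz => ?_⟩
  have hr := rem_pos hT hz
  rw [(velocityExt_eventuallyEq hz).fderiv_eq]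
  have hD := ((contDiffAt_scaled (a := γ * (β - 1)) (γ := γ) hT contDiff_profile hz).differentiableAt
    (by simp)).hasFDerivAt
  change HasFDerivAt (fun z : ℝ × E3 => velocity T γ β z.1 z.2)
    (fderiv ℝ (fun z : ℝ × E3 => velocity T γ β z.1 z.2) z) z at hD
  set L := fderiv ℝ (fun z : ℝ × E3 => velocity T γ β z.1 z.2) z
  have hLt : ∀ s : ℝ, ‖L (s, 0)‖ ≤ C₃ * rem T z.1 ^ (γ * (β - 1) - 1) * |s| := by
    intro s
    have h1 : HasDerivAt (fun t : ℝ => (t, z.2)) ((1 : ℝ), (0 : E3)) z.1 :=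
      (hasDerivAt_id z.1).prodMk (hasDerivAt_const _ _)
    have h0 : HasDerivAt (fun t => velocity T γ β t z.2) (L (1, 0)) z.1 :=
      HasFDerivAt.comp_hasDerivAt (l := fun z : ℝ × E3 => velocity T γ β z.1 z.2) z.1 hD h1
    have h2 := h0.unique (hasDerivAt_scaled hT hz contDiff_profile z.2)
    have h3 : ((s, 0) : ℝ × E3) = s • ((1 : ℝ), (0 : E3)) := by simp
    rw [h3, map_smul, h2, norm_smul, Real.norm_eq_abs, mul_comm]
    exact mul_le_mul_of_nonneg_right (norm_scaled_le hr.le hb₃ _) (abs_nonneg _)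
  have hLx : ∀ y : E3, ‖L (0, y)‖ ≤ C₁ * rem T z.1 ^ (γ * (β - 1) - γ) * ‖y‖ := by
    intro y
    have h1 : HasFDerivAt (fun x : E3 => (z.1, x)) (ContinuousLinearMap.inr ℝ ℝ E3) z.2 :=
      hasFDerivAt_prodMk_right z.1 z.2
    have h0 : HasFDerivAt (velocity T γ β z.1) (L.comp (ContinuousLinearMap.inr ℝ ℝ E3)) z.2 :=
      HasFDerivAt.comp (g := fun z : ℝ × E3 => velocity T γ β z.1 z.2) z.2 hD h1
    have h2 := h0.unique (hasFDerivAt_scaled hT hz contDiff_profile z.2)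
    have h3 : L (0, y) = scaled T γ (γ * (β - 1) - γ) (fderiv ℝ profile) z.1 z.2 y := by
      rw [← h2]; rfl
    rw [h3]
    exact (ContinuousLinearMap.le_opNorm _ _).trans
      (mul_le_mul_of_nonneg_right (norm_scaled_le hr.le hb₁ _) (norm_nonneg _))
  refine ContinuousLinearMap.opNorm_le_bound _ (by positivity) fun y => ?_
  have hy : y = (y.1, 0) + (0, y.2) := by simp
  rw [hy, map_add, ← hy]
  refine (norm_add_le _ _).trans ((add_le_add (hLt _) (hLx _)).trans ?_)
  have e1 : |y.1| ≤ ‖y‖ := norm_fst_le y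
  have e2 : ‖y.2‖ ≤ ‖y‖ := norm_snd_le y
  have p1 : 0 ≤ rem T z.1 ^ (γ * (β - 1) - 1) := by positivity
  have p2 : 0 ≤ rem T z.1 ^ (γ * (β - 1) - γ) := by positivity
  calc _ ≤ C₃ * rem T z.1 ^ (γ * (β - 1) - 1) * ‖y‖ + C₁ * rem T z.1 ^ (γ * (β - 1) - γ) * ‖y‖ := by
        gcongr
    _ ≤ _ := by
        rw [← add_mul]
        refine mul_le_mul_of_nonneg_right ?_ (norm_nonneg _)
        nlinarith [mul_nonneg hC₃ p2, mul_nonneg hC₁ p1]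

theorem contDiff_velocityExt (hT : 0 < T) (h1 : 1 < γ * (β - 1)) (h2 : 0 < γ * (β - 1) - γ) :
    ContDiff ℝ 1 (velocityExt T γ β) := by
  obtain ⟨C, hC, hb⟩ := norm_velocity_le
  have hz : ∀ z : ℝ × E3, T ≤ z.1 → velocityExt T γ β z = 0 := fun z h => if_neg (not_lt.2 h)
  have hb' : ∀ z : ℝ × E3, z.1 < T → ‖velocityExt T γ β z‖ ≤ C * rem T z.1 ^ (γ * (β - 1)) :=
    fun z h => by rw [velocityExt, if_pos h]; exact hb hT _ h _
  have h0 := fun (z : ℝ × E3) (h : T ≤ z.1) => hasFDerivAt_zero_of_norm_le_rem_rpow hT h1 hz hb' h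
  rw [contDiff_one_iff_fderiv]
  refine ⟨fun z => ?_, ?_⟩
  · rcases lt_or_ge z.1 T with h | h
    · exact (contDiffAt_velocityExt hT h).differentiableAt (by simp)
    · exact (h0 z h).differentiableAt
  obtain ⟨C', hb''⟩ := norm_fderiv_velocityExt_le (γ := γ) (β := β) hT
  refine continuous_of_norm_le_rem_rpow hT (by linarith) h2 (fun z hz => ?_)
    (fun z hz => (h0 z hz).fderiv) hb''
  exact ((contDiffAt_velocityExt hT hz).fderiv_right (m := 0) (by simp)).continuousAt

end

/-! ### The exponents -/

/-- Used with c = 3 for the force and c = 1 for the velocity. A positive number times ⊤ is ⊤ in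
`EReal`, so for q = ⊤ the hypothesis forces (c-α)p ≤ 2. -/
theorem nonneg_exponent_of_lt_top {c α β γ p : ℝ} {q : ℝ≥0∞} (hαβ : α ≤ β) (hγ : 0 ≤ γ) (hp : 0 < p)
    (h : (((c - α) * p - 2 : ℝ) : EReal) * (q : EReal) < 2) (hq : q = ⊤) :
    0 ≤ γ * (β - c + 2 / p) := by
  have h1 : (c - α) * p - 2 ≤ 0 := by
    by_contra hcon
    rw [hq, EReal.coe_ennreal_top, EReal.coe_mul_top_of_pos (not_le.1 hcon)] at h
    exact absurd h (not_lt.2 le_top)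
  have h2 : (c - β) * p ≤ 2 := by nlinarith
  refine mul_nonneg hγ ?_
  have h3 : c - β ≤ 2 / p := (le_div_iff₀ hp).2 h2
  linarith

/-- If (c-β)p ≤ 2 the exponent is nonnegative. Otherwise 2γ ≤ p replaces γ/p by 1/2, and the
hypothesis on q is exactly what remains. -/
theorem neg_one_lt_exponent_of_lt {c α β γ p : ℝ} {q : ℝ≥0∞} (hαβ : α ≤ β) (hγ : 0 ≤ γ) (hp : 0 < p)
    (hγp : 2 < (c - β) * p → 2 * γ ≤ p)
    (h : (((c - α) * p - 2 : ℝ) : EReal) * (q : EReal) < 2) (hq : q ≠ ⊤) :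
    -1 < q.toReal * (γ * (β - c + 2 / p)) := by
  have h1 : ((c - α) * p - 2) * q.toReal < 2 := by
    rw [← ENNReal.ofReal_toReal hq, EReal.coe_ennreal_ofReal, max_eq_left ENNReal.toReal_nonneg,
      ← EReal.coe_mul] at h
    rwa [show (2 : EReal) = ((2 : ℝ) : EReal) from rfl, EReal.coe_lt_coe_iff] at h
  have hq0 : 0 ≤ q.toReal := ENNReal.toReal_nonneg
  have e : q.toReal * (γ * (β - c + 2 / p)) = -(q.toReal * γ * ((c - β) * p - 2)) / p := by
    field_simp; ring
  rw [e, lt_div_iff₀ hp]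
  rcases le_or_gt ((c - β) * p) 2 with hX | hX
  · have := mul_nonneg (mul_nonneg hq0 hγ) (sub_nonneg.2 hX)
    nlinarith
  · have h2 := hγp hX
    have h3 : ((c - β) * p - 2) * q.toReal < 2 :=
      lt_of_le_of_lt (mul_le_mul_of_nonneg_right (by nlinarith) hq0) h1
    rcases hγ.eq_or_lt with rfl | hγ'
    · simp; exact hp
    · nlinarith

end SwirlNS

end

/-! ### The choice of the exponents and the conclusion -/

open SwirlNS
theorem theorem1 (T : ℝ) (hT : 0 < T) (k : ℕ) (hk1 : 1 ≤ k) (hk3 : k ≤ 3)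
    (α : ℝ) (hα1 : (k : ℝ) - 1 ≤ α) (hα2 : α < k)
    (q : ℝ≥0∞) (hq : 1 ≤ q) (p : ℝ) (hp : 1 ≤ p)
    (hqp : (((3 - α) * p - 2 : ℝ) : EReal) * (q : EReal) < 2) :
    ∃ f v : ℝ → E3 → E3,
      MemLtLx T q (ENNReal.ofReal p) f ∧ SmoothST T f ∧
      IsClassicalSolution T f v ∧
      MemLtLx T ⊤ 2 v ∧ MemLtwoHone T v ∧
      -- uniqueness, among smooth solutions and among Leray-Hopf solutions, for the same force
      -- and the same initial velocity
      (∀ w : ℝ → E3 → E3, IsClassicalSolution T f w → (∀ x ∈ cyl, w 0 x = v 0 x) →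
        ∀ t ∈ Ico 0 T, ∀ x ∈ cyl, w t x = v t x) ∧
      IsLerayHopf T f (v 0) v ∧
      (∀ w : ℝ → E3 → E3, IsLerayHopf T f (v 0) w →
        ∀ᵐ t ∂(volume.restrict (Ioo 0 T)), ∀ᵐ x ∂(volume.restrict cyl), w t x = v t x) ∧
      IsSwirl T α v ∧
      Tendsto (fun t => eLpNorm (iteratedFDerivWithin ℝ (k - 1) (v t) cyl) ⊤ (volume.restrict cyl))
        (𝓝[<] T) (𝓝 ⊤) ∧
      (∀ (q' : ℝ≥0∞) (p' : ℝ), 1 ≤ q' → 1 ≤ p' →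
        (((1 - α) * p' - 2 : ℝ) : EReal) * (q' : EReal) < 2 →
        MemLtLx T q' (ENNReal.ofReal p') v) ∧
      (2 ≤ k → ContDiffOn ℝ ((k - 2 : ℕ) : WithTop ℕ∞) (fun z : ℝ × E3 => v z.1 z.2)
        (Icc 0 T ×ˢ cyl)) := by
  -- Blow-up needs β < k and the integrability claims need β ≥ α. The lower bound k - 1/2 gives β >
  -- 0 for the energy norms, β > 1 for continuity at T if k = 2, and β > 2 for C¹ if k = 3.
  set β : ℝ := max α (k - 1 / 2) with hβ
  have hαβ : α ≤ β := le_max_left _ _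
  have hβ1 : (k : ℝ) - 1 / 2 ≤ β := le_max_right _ _
  have hβk : β < k := max_lt hα2 (by linarith)
  have hk1' : (1 : ℝ) ≤ k := by exact_mod_cast hk1
  have hk3' : (k : ℝ) ≤ 3 := by exact_mod_cast hk3
  have h3β : 0 < 3 - β := by linarith
  -- This is the largest γ with 2γ ≤ p for every p ≥ 1 such that (3-β)p > 2, as the force requires.
  -- A large γ is needed for differentiability in time at T when k = 3.
  set γ : ℝ := max (1 / 2) (1 / (3 - β)) with hγdef
  have hγ : 1 / 2 ≤ γ := le_max_left _ _
  have hγ0 : 0 < γ := by linarith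
  have hγ1 : β < 1 → γ = 1 / 2 := fun h => max_eq_left
    (one_div_le_one_div_of_le two_pos (by linarith))
  have hγ2 : 1 ≤ γ * (3 - β) := (div_le_iff₀ h3β).1 (le_max_right _ _)
  have hp0 : 0 < p := by linarith
  have hcl := isClassicalSolution_velocity (β := β) hT hγ0.le
  have hvt : MemLtLx T ⊤ 2 (velocity T γ β) := by
    have := memLtLx_velocity (T := T) (γ := γ) (β := β) (q := ⊤) hT two_pos
      (fun _ => mul_nonneg hγ0.le (by linarith)) (by simp)
    rwa [ENNReal.ofReal_ofNat] at this
  have hv2 : MemLtLx T 2 2 (velocity T γ β) := by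
    have h0 : 0 ≤ γ * (β - 1 + 2 / 2) := mul_nonneg hγ0.le (by linarith)
    have := memLtLx_velocity (T := T) (γ := γ) (β := β) (q := 2) hT two_pos
      (by simp) (fun _ => by rw [ENNReal.toReal_ofNat]; linarith)
    rwa [ENNReal.ofReal_ofNat] at this
  have hG : ∀ j, MemLtLx T 2 2 (fun t => pd j (velocity T γ β t)) := by
    refine memLtLx_pd_velocity hT ?_
    rcases lt_or_ge β 1 with h | h
    · rw [hγ1 h]; linarith
    · nlinarith
  refine ⟨force T γ β, velocity T γ β, ?_, smoothST_force hT, hcl, hvt, ⟨hv2, _, hG, ?_⟩,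
    fun w hw h0 => hcl.unique hw h0, hcl.isLerayHopf hT hvt hG,
    fun w hw => hcl.ae_eq_of_isLerayHopf hw, isSwirl_velocity hT hγ0.le, ?_, ?_, ?_⟩
  · refine memLtLx_force hT hγ hp0 (nonneg_exponent_of_lt_top hαβ hγ0.le hp0 hqp)
      (neg_one_lt_exponent_of_lt hαβ hγ0.le hp0 (fun h => ?_) hqp)
    rcases max_cases (1 / 2 : ℝ) (1 / (3 - β)) with ⟨h1, -⟩ | ⟨h1, -⟩
    · rw [hγdef, h1]; linarith
    · rw [hγdef, h1, ← mul_div_assoc, mul_one, div_le_iff₀ h3β]; linarith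
  · exact (ae_restrict_iff' measurableSet_Ioo).2 (Eventually.of_forall fun t ht =>
      (hcl.isWeakGradBC (Ioo_subset_Ico_self ht)).isWeakGrad)
  · refine tendsto_eLpNorm_iteratedFDerivWithin_velocity hT hγ0 ?_
    rw [Nat.cast_sub hk1]; push_cast; linarith
  · intro q' p' _ hp' h
    have hp'0 : 0 < p' := by linarith
    refine memLtLx_velocity hT hp'0 (nonneg_exponent_of_lt_top hαβ hγ0.le hp'0 h)
      (neg_one_lt_exponent_of_lt hαβ hγ0.le hp'0 (fun h => ?_) h)
    -- The case (1-β)p' > 2 forces β < 1, hence γ = 1/2 and 2γ = 1 ≤ p'.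
    rw [hγ1 (by nlinarith)]; linarith
  · intro hk
    obtain rfl | rfl : k = 2 ∨ k = 3 := by omega
    · push_cast at hβ1
      have he : 0 < γ * (β - 1) := mul_pos hγ0 (by linarith)
      simp only [Nat.sub_self, Nat.cast_zero]
      exact contDiffOn_zero.2 ((continuous_velocityExt hT he).continuousOn.congr
        (velocityExt_eq hT he.ne'))
    · push_cast at hβ1
      -- From γ(3-β) ≥ 1 and β - 1 > 3 - β, the latter because β > 2.
      have he : 1 < γ * (β - 1) := by nlinarith
      exact (contDiff_velocityExt hT he (by nlinarith)).contDiffOn.congr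
        (velocityExt_eq hT (by linarith))
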